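/- Let $a\in\mathbb{N}^{+}$, let $d$ be a real number with $ad\in\mathbb{N}=\{0,1,2,\dots\}$, and let $c>0$ be real. The generalized Bessel triangle $[\mathcal{T}_{n,k}]_{n,k\ge 0}$ is the lower-triangular array of polynomials in $b,\lambda$ given by $\mathcal{T}_{0,0}=1$, $\mathcal{T}_{0,k}=0$ for $k\ge1$, and, for $n\ge 1$ and $k\ge 0$ (with $\mathcal{T}_{n-1,-1}=0$), $$\mathcal{T}_{n,k}=c\,\mathcal{T}_{n-1,k-1}+\left[ab(n-1)-bk+abd+c\lambda\right]\mathcal{T}_{n-1,k}-b\lambda(k+1)\mathcal{T}_{n-1,k+1}.$$ Let $\mathcal{T}_n(q)=\sum_{k\ge0}\mathcal{T}_{n,k}q^k$. Terminology. Let $\mathbf{x}$ be a finite set of indeterminates. An infinite matrix over $\mathbb{R}[\mathbf{x}]$ is $\mathbf{x}$-TP if all its minors are polynomials with nonnegative coefficients. A sequence $(\alpha_n)_{n\ge0}$ in $\mathbb{R}[\mathbf{x}]$ is $\mathbf{x}$-SM if its Hankel matrix $[\alpha_{i+j}]_{i,j\ge0}$ is $\mathbf{x}$-TP; it is $3$-$\mathbf{x}$-log-convex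 if for every $0\le m\le3$ all terms of $\mathcal{L}^m[\alpha]$ (defined at the indices $i\ge m$) have nonnegative coefficients, where $\mathcal{L}[\alpha_i]=\alpha_{i-1}\alpha_{i+1}-\alpha_i^2$. A real sequence $(\alpha_n)_{n\ge0}$ is a Stieltjes moment (SM) sequence if $\alpha_n=\int_0^\infty x^n\,d\mu(x)$ for all $n\geq 0$, for some nonnegative measure $\mu$ on $[0,\infty)$ (with all these integrals finite). For $a=2$, $b=c=1$, $\lambda=d=0$, the triangle consists of the signless Bessel numbers of the first kind $b_{n,k}$, defined by $b_{0,0}=1$, $b_{n,k}=0$ for $k>n$, and $y_{n-1}(q)=\sum_{k=0}^{n}b_{n,k}q^{n-k}$ for $n\ge1$, where $y_n(q)=\sum_{k=0}^n\frac{(n+k)!}{(n-k)!\,k!}\left(\frac q2\right)^k$. In general: (i) For all $n,k\ge0$ and all real $b,\lambda$, $$\mathcal{T}_{n,k}=\frac{a^n}{k!}\sum_{j\ge0}\sum_{i=0}^{k+j}\frac{(-1)^{n-i}b^{n-k-j}c^{k+j}\lambda^j}{j!}\binom{k+j}{i}\left(\frac{i-ad}{a}\right)_n,$$ where $(x)_n=x(x-1)\cdots(x-n+1)$.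 (For $b=0$ we put $0^0=1$ and read negative powers of $b$ as $0$.) (ii) The matrix $[\mathcal{T}_{n,k}]_{n,k\ge0}$ is $(b,\lambda)$-TP. (iii) If $0\le ad\le a-1$, then $(\mathcal{T}_n(q))_{n\ge0}$ is $(b,\lambda,q)$-SM and $3$-$(b,\lambda,q)$-log-convex. In particular, $(\mathcal{T}_{n,0})_{n\ge0}$ is $(b,\lambda)$-SM and $3$-$(b,\lambda)$-log-convex. (iv) For every real $b>0$, the sequence $(f_n)_{n\ge1}$ defined, for $t$ near $0$, by $\sum_{n\ge1}f_n\frac{t^n}{n!}=\frac cb\left[1-(1-abt)^{1/a}\right]$ is SM, that is, $(f_{n+1})_{n\ge0}$ is an SM sequence. (v) If $0\le ad\le a-1$ and $b,\lambda\ge0$ are real, then the convolution $z_n=\sum_{k=0}^n\mathcal{T}_{n,k}x_ky_{n-k}$ preserves the Stieltjes moment property: whenever $(x_n)_{n\ge0}$ and $(y_n)_{n\ge0}$ are SM sequences, so is $(z_n)_{n\ge0}$. -/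

import Mathlib

open MeasureTheory

/-- The generalized Bessel triangle `T n k` with parameters `a`, `d`, `c` and with `b`, `lam` in an
arbitrary commutative `ℝ`-algebra `R` (so that `b`, `lam` may be real numbers or indeterminates):
`T (n+1) k = c T n (k-1) + (a b n - b k + a b d + c lam) T n k - b lam (k+1) T n (k+1)`
with `T n (-1) = 0`, `T 0 0 = 1` and `T 0 k = 0` for `0 < k`. -/
noncomputable def genBessel {R : Type*} [CommRing R] [Algebra ℝ R]
    (a : ℕ) (d c : ℝ) (b lam : R) : ℕ → ℕ → R
  | 0, 0 => 1
  | 0, _ + 1 => 0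
  | n + 1, 0 =>
      (((a : ℝ) * n + a * d) • b + c • lam) * genBessel a d c b lam n 0
        - b * lam * genBessel a d c b lam n 1
  | n + 1, k + 1 =>
      c • genBessel a d c b lam n k
        + (((a : ℝ) * n - (k + 1) + a * d) • b + c • lam) * genBessel a d c b lam n (k + 1)
        - (k + 2) * (b * lam) * genBessel a d c b lam n (k + 2)

/-- The triangle is lower triangular, so sums over all `k` of its `n`-th row reduce to `k ≤ n`. -/
theorem genBessel_eq_zero_of_lt {R : Type*} [CommRing R] [Algebra ℝ R]
    (a : ℕ) (d c : ℝ) (b lam : R) (n : ℕ) :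
    ∀ k : ℕ, n < k → genBessel a d c b lam n k = 0 := by
  induction n with
  | zero =>
    intro k hk
    cases k with
    | zero => omega
    | succ k => simp [genBessel]
  | succ n ih =>
    intro k hk
    cases k with
    | zero => omega
    | succ k =>
      simp [genBessel, ih k (by omega), ih (k + 1) (by omega), ih (k + 2) (by omega)]

/-- The row polynomial `T_n(q) = ∑_k T n k q^k`, with `q` in the same ring as `b`, `lam`. -/
noncomputable def genBesselRow {R : Type*} [CommRing R] [Algebra ℝ R]
    (a : ℕ) (d c : ℝ) (b lam q : R) (n : ℕ) : R :=
  ∑ k ∈ Finset.range (n + 1), genBessel a d c b lam n k * q ^ k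

/-- A real polynomial all of whose coefficients are nonnegative. -/
def NonnegCoeffs {σ : Type*} (P : MvPolynomial σ ℝ) : Prop :=
  ∀ m : σ →₀ ℕ, 0 ≤ MvPolynomial.coeff m P

/-- Coefficientwise total positivity of an infinite matrix of polynomials: every minor
is a polynomial with nonnegative coefficients. -/
def CoeffTP {σ : Type*} (M : ℕ → ℕ → MvPolynomial σ ℝ) : Prop :=
  ∀ (r : ℕ) (row col : Fin r → ℕ), StrictMono row → StrictMono col →
    NonnegCoeffs (Matrix.det (Matrix.of fun i j => M (row i) (col j)))

/-- Coefficientwise Stieltjes moment property of a sequence of polynomials: its infinite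
Hankel matrix is coefficientwise totally positive. -/
def CoeffSM {σ : Type*} (α : ℕ → MvPolynomial σ ℝ) : Prop :=
  CoeffTP fun i j => α (i + j)

/-- The log-convexity operator `α_{i-1} α_{i+1} - α_i ^ 2` (`i ≥ 1`), reindexed to start at `0`. -/
def logConvexOp {R : Type*} [CommRing R] (α : ℕ → R) : ℕ → R :=
  fun n => α n * α (n + 2) - α (n + 1) ^ 2

/-- Coefficientwise `k`-log-convexity: the sequence and its first `k` iterates under the
log-convexity operator have nonnegative coefficients. -/
def CoeffLogConvex {σ : Type*} (k : ℕ) (α : ℕ → MvPolynomial σ ℝ) : Prop :=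
  ∀ m ≤ k, ∀ n : ℕ, NonnegCoeffs (logConvexOp^[m] α n)

/-- Stieltjes moment sequences of real numbers: `α n = ∫ x ^ n dμ` for a nonnegative measure
`μ` on `[0, ∞)`. -/
def IsStieltjesMoment (α : ℕ → ℝ) : Prop :=
  ∃ μ : Measure ℝ, μ (Set.Iio 0) = 0 ∧
    ∀ n : ℕ, Integrable (fun x : ℝ => x ^ n) μ ∧ ∫ x, x ^ n ∂μ = α n

/-- The convolution `z n = ∑_{k ≤ n} A n k * x k * y (n - k)` preserves the Stieltjes moment
property. -/
def ConvolutionPreservesSM (A : ℕ → ℕ → ℝ) : Prop :=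
  ∀ x y : ℕ → ℝ, IsStieltjesMoment x → IsStieltjesMoment y →
    IsStieltjesMoment fun n => ∑ k ∈ Finset.range (n + 1), A n k * x k * y (n - k)

/-- The Bessel polynomial `y_n(q) = ∑_{k=0}^n (n+k)! / ((n-k)! k!) (q/2)^k`. -/
noncomputable def besselPolynomial (n : ℕ) : Polynomial ℝ :=
  ∑ k ∈ Finset.range (n + 1),
    Polynomial.C (((n + k).factorial : ℝ) / ((n - k).factorial * k.factorial) / 2 ^ k) *
      Polynomial.X ^ k

/-- The signless Bessel numbers of the first kind, `y_{n-1}(q) = ∑_{k ≤ n} b_{n,k} q^{n-k}` for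
`n ≥ 1`, with `b_{0,0} = 1`, and `b_{n,k} = 0` for `k > n`. -/
noncomputable def signlessBessel : ℕ → ℕ → ℝ
  | 0, k => if k = 0 then 1 else 0
  | n + 1, k => if k ≤ n + 1 then (besselPolynomial n).coeff (n + 1 - k) else 0

/-!
Let `T_n(q)` be the row polynomial, `β = b / c`, `D = d/dq` and `N = c (q + λ) (1 - β D)`. The
recurrence reads `T_{n+1} = (N + a (n + d) b) T_n`. Both `c (q + λ)` and `(1 - β D)⁻¹` raise `N` by
`b`, so `T_n = (1 - β D)^{-ad} (c (q + λ) (1 - β D)^{1-a})^n 1`. The factors have totally positive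
matrices in the monomial basis, hence so has the triangle by the Cauchy–Binet formula. Taylor
expansion gives `T_n(q) = T_{n,0}` at `λ + q`, so the row polynomials reduce to the zeroth column.
If `ad ≤ a - 1`, then conjugation turns `T_n` into `L^n 1` for a totally positive `L`, so the Hankel
matrix of the zeroth column is totally positive; the Desnanot–Jacobi identity then gives
3-log-convexity.

For real parameters, `T_{n,0}` is, up to constants, the `n`-th derivative at `w = 1` of
`w^{-d} exp(-(c λ / b) w^{1/a})`, whose derivatives have alternating signs. Its Taylor expansion at
`1 + r` exhibits `T_{n,0}`, up to constants, as the factorial moments of a nonnegative measure on a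
lattice of step `1 / r`. Letting `r → ∞` gives positivity of the moment functional, hence a
representing measure by Haviland's theorem. By homogeneity, the convolution of two moment sequences
is an average of such zeroth columns.
-/

/-! ### The Cauchy–Binet formula -/

section CauchyBinet

open Matrix

variable {R κ : Type*} [CommRing R] {r : ℕ}

theorem det_mul_eq_sum_prod_mul_det [Fintype κ] (A : Matrix (Fin r) κ R)
    (B : Matrix κ (Fin r) R) :
    (A * B).det = ∑ f : Fin r → κ, (∏ i, A i (f i)) * (B.submatrix f id).det := by
  classical
  have expand_rows := (detRowAlternating (R := R) (n := Fin r)).toMultilinearMap.map_sum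
    fun i k => A i k • B k
  have rows_eq : (fun i => ∑ k, A i k • B k) = A * B := by
    ext i j
    simp [mul_apply, Finset.sum_apply]
  rw [rows_eq] at expand_rows
  exact expand_rows.trans <| Finset.sum_congr rfl fun f _ => MultilinearMap.map_smul_univ _ _ _

theorem sum_perm_prod_mul_det (A : Matrix (Fin r) κ R) (B : Matrix κ (Fin r) R)
    (g : Fin r → κ) :
    ∑ σ : Equiv.Perm (Fin r), (∏ i, A i (g (σ i))) * (B.submatrix (g ∘ σ) id).det =
      (A.submatrix id g).det * (B.submatrix g id).det := by
  rw [← det_transpose (A.submatrix id g), det_apply', Finset.sum_mul]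
  refine Finset.sum_congr rfl fun σ _ => ?_
  rw [show B.submatrix (g ∘ σ) id = (B.submatrix g id).submatrix σ id from rfl, det_permute]
  simp only [transpose_apply, submatrix_apply, id]
  ring

theorem comp_perm_comp_sort [LinearOrder κ] {g : Fin r → κ} (hg : StrictMono g)
    (σ : Equiv.Perm (Fin r)) : (g ∘ σ) ∘ Tuple.sort (g ∘ σ) = g := by
  have comp_inv : (g ∘ σ) ∘ ⇑σ⁻¹ = g := by
    ext i
    simp
  have monotone_comp_inv : Monotone ((g ∘ σ) ∘ ⇑σ⁻¹) := by
    rw [comp_inv]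
    exact hg.monotone
  exact (Tuple.comp_sort_eq_comp_iff_monotone.2 monotone_comp_inv).symm.trans comp_inv

theorem sort_comp_perm [LinearOrder κ] {g : Fin r → κ} (hg : StrictMono g)
    (σ : Equiv.Perm (Fin r)) : Tuple.sort (g ∘ σ) = σ⁻¹ := by
  ext1 i
  exact σ.injective (hg.injective (by simpa using congrFun (comp_perm_comp_sort hg σ) i))

open Classical in
theorem sum_injective_eq_sum_strictMono_perm [Fintype κ] [LinearOrder κ] {M : Type*}
    [AddCommMonoid M] (F : (Fin r → κ) → M) :
    ∑ f with Function.Injective f, F f =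
      ∑ g with StrictMono g, ∑ σ : Equiv.Perm (Fin r), F (g ∘ σ) := by
  rw [← Finset.sum_product']
  refine (Finset.sum_nbij' (fun p => p.1 ∘ p.2)
    (fun f => (f ∘ Tuple.sort f, (Tuple.sort f)⁻¹)) ?_ ?_ ?_ ?_ ?_).symm
  · rintro ⟨g, σ⟩ hg
    simp only [Finset.mem_product, Finset.mem_filter, Finset.mem_univ, true_and, and_true] at hg ⊢
    exact hg.injective.comp σ.injective
  · intro f hf
    simp only [Finset.mem_product, Finset.mem_filter, Finset.mem_univ, true_and, and_true] at hf ⊢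
    exact (Tuple.monotone_sort f).strictMono_of_injective (hf.comp (Tuple.sort f).injective)
  · rintro ⟨g, σ⟩ hg
    simp only [Finset.mem_product, Finset.mem_filter, Finset.mem_univ, true_and, and_true] at hg
    exact Prod.ext (comp_perm_comp_sort hg σ) (by simp [sort_comp_perm hg])
  · intro f _
    ext i
    simp
  · intro p _
    rfl

open Classical in
theorem det_mul_eq_sum_strictMono [Fintype κ] [LinearOrder κ] (A : Matrix (Fin r) κ R)
    (B : Matrix κ (Fin r) R) :
    (A * B).det =
      ∑ g : Fin r → κ with StrictMono g, (A.submatrix id g).det * (B.submatrix g id).det := by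
  have det_eq_zero_of_not_injective (f : Fin r → κ) (hf : ¬ Function.Injective f) :
      (B.submatrix f id).det = 0 := by
    obtain ⟨i, j, hij, hne⟩ := Function.not_injective_iff.1 hf
    exact det_zero_of_row_eq hne (by ext; simp [hij])
  calc (A * B).det
      = ∑ f : Fin r → κ, (∏ i, A i (f i)) * (B.submatrix f id).det :=
        det_mul_eq_sum_prod_mul_det A B
    _ = ∑ f : Fin r → κ with Function.Injective f, (∏ i, A i (f i)) * (B.submatrix f id).det :=
        (Finset.sum_filter_of_ne fun f _ h => not_imp_comm.1
          (fun hf => by rw [det_eq_zero_of_not_injective f hf, mul_zero]) h).symm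
    _ = _ := by
        simp_rw [sum_injective_eq_sum_strictMono_perm, Function.comp_apply,
          sum_perm_prod_mul_det]

end CauchyBinet

/-! ### Total positivity -/

section Determinant

variable {R : Type*} [CommRing R] {r : ℕ}

theorem det_eq_of_first_row_eq_zero (M : Matrix (Fin (r + 1)) (Fin (r + 1)) R)
    (h : ∀ j : Fin r, M 0 j.succ = 0) :
    M.det = M 0 0 * (M.submatrix Fin.succ Fin.succ).det := by
  simp [Matrix.det_succ_row_zero, Fin.sum_univ_succ, h, Fin.succAbove_zero]

theorem det_eq_of_first_col_eq_zero (M : Matrix (Fin (r + 1)) (Fin (r + 1)) R)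
    (h : ∀ i : Fin r, M i.succ 0 = 0) :
    M.det = M 0 0 * (M.submatrix Fin.succ Fin.succ).det := by
  simp [Matrix.det_succ_column_zero, Fin.sum_univ_succ, h, Fin.succAbove_zero]

theorem det_eq_zero_of_col_eq_smul (M : Matrix (Fin r) (Fin r) R) {j k : Fin r} (hjk : j ≠ k)
    (s : R) (h : ∀ i, M i j = s * M i k) : M.det = 0 := by
  have column_eq : M = M.updateCol j (s • fun i => M i k) := by
    ext i l
    rcases eq_or_ne l j with rfl | hl
    · simp [h]
    · simp [hl]
  rw [column_eq, Matrix.det_updateCol_smul, Matrix.det_zero_of_column_eq hjk, mul_zero]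
  simp [hjk.symm]

theorem lt_of_strictMono_succ {f : Fin (r + 1) → ℕ} (hf : StrictMono f) (i : Fin r) :
    f 0 < f i.succ :=
  hf i.succ_pos

end Determinant

/-- The infinite matrix `M` is totally positive with respect to the subsemiring `S`: all its minors
lie in `S`. For `S` the polynomials with nonnegative coefficients this is `CoeffTP`. -/
def IsTP {R : Type*} [CommRing R] (S : Subsemiring R) (M : ℕ → ℕ → R) : Prop :=
  ∀ (r : ℕ) (row col : Fin r → ℕ), StrictMono row → StrictMono col →
    Matrix.det (Matrix.of fun i j => M (row i) (col j)) ∈ S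

namespace IsTP

open Filter

variable {R : Type*} [CommRing R] {S : Subsemiring R} {A B M : ℕ → ℕ → R} {r : ℕ}

theorem det_sum_mul_mem {C : Fin r → Fin r → R} {row col : Fin r → ℕ}
    (hA : ∀ g : Fin r → ℕ, StrictMono g → (Matrix.of fun i j => A (row i) (g j)).det ∈ S)
    (hB : ∀ g : Fin r → ℕ, StrictMono g → (Matrix.of fun i j => B (g i) (col j)).det ∈ S)
    (hC : ∀ i j, ∀ᶠ K in atTop, C i j = ∑ k ∈ Finset.range K, A (row i) k * B k (col j)) :
    (Matrix.of C).det ∈ S := by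
  obtain ⟨K, hK⟩ := (eventually_all.2 fun i => eventually_all.2 (hC i)).exists
  have factorization : Matrix.of C = (Matrix.of fun i (k : Fin K) => A (row i) k) *
      Matrix.of fun (k : Fin K) j => B k (col j) := by
    ext i j
    simp [Matrix.mul_apply, hK i j, Finset.sum_range]
  rw [factorization, det_mul_eq_sum_strictMono]
  refine S.sum_mem fun g hg => ?_
  have strictMono_val : StrictMono fun i => (g i : ℕ) := (Finset.mem_filter.1 hg).2
  exact S.mul_mem (hA _ strictMono_val) (hB _ strictMono_val)

theorem transpose (h : IsTP S M) : IsTP S fun i j => M j i := by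
  intro r row col hrow hcol
  rw [← Matrix.det_transpose]
  exact h r col row hcol hrow

theorem mul {C : ℕ → ℕ → R} (hA : IsTP S A) (hB : IsTP S B)
    (hC : ∀ i j, ∀ᶠ K in atTop, C i j = ∑ k ∈ Finset.range K, A i k * B k j) : IsTP S C :=
  fun r row col hrow hcol => det_sum_mul_mem (fun g hg => hA r row g hrow hg)
    (fun g hg => hB r g col hg hcol) fun _ _ => hC _ _

theorem bidiagonal {s t : ℕ → R} (hs : ∀ i, s i ∈ S) (ht : ∀ i, t i ∈ S) :
    IsTP S fun i j => if j = i then s i else if j = i + 1 then t i else 0 := by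
  intro r
  induction r with
  | zero => simp
  | succ r ih =>
    intro row col hrow hcol
    have entry_mem (i j : ℕ) : (if j = i then s i else if j = i + 1 then t i else 0) ∈ S := by
      split_ifs
      exacts [hs i, ht i, S.zero_mem]
    have minor_mem := ih (row ∘ Fin.succ) (col ∘ Fin.succ) (hrow.comp Fin.strictMono_succ)
      (hcol.comp Fin.strictMono_succ)
    rcases le_or_gt (col 0) (row 0) with h | h
    · rw [det_eq_of_first_col_eq_zero]
      · exact S.mul_mem (entry_mem _ _) minor_mem
      · intro i
        have := lt_of_strictMono_succ hrow i
        simp only [Matrix.of_apply]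
        rw [if_neg (by omega), if_neg (by omega)]
    · rw [det_eq_of_first_row_eq_zero]
      · exact S.mul_mem (entry_mem _ _) minor_mem
      · intro j
        have := lt_of_strictMono_succ hcol j
        simp only [Matrix.of_apply]
        rw [if_neg (by omega), if_neg (by omega)]

theorem prod_Ioc {s : ℕ → R} (hs : ∀ i, s i ∈ S) :
    IsTP S fun i j => if j ≤ i then ∏ k ∈ Finset.Ioc j i, s k else 0 := by
  intro r
  induction r with
  | zero => simp
  | succ r ih =>
    intro row col hrow hcol
    by_cases h : ∃ j : Fin r, col j.succ ≤ row 0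
    · obtain ⟨j, hj⟩ := h
      have col_zero_lt := lt_of_strictMono_succ hcol j
      rw [det_eq_zero_of_col_eq_smul _ j.succ_ne_zero.symm
        (∏ k ∈ Finset.Ioc (col 0) (col j.succ), s k) fun i => ?_]
      · exact S.zero_mem
      · have hi : col j.succ ≤ row i := hj.trans (hrow.monotone (Fin.zero_le i))
        simp only [Matrix.of_apply]
        rw [if_pos hi, if_pos (col_zero_lt.le.trans hi),
          Finset.prod_Ioc_consecutive _ col_zero_lt.le hi]
    · push Not at h
      rw [det_eq_of_first_row_eq_zero _ fun j => if_neg (h j).not_ge]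
      refine S.mul_mem ?_ <| ih (row ∘ Fin.succ) (col ∘ Fin.succ)
        (hrow.comp Fin.strictMono_succ) (hcol.comp Fin.strictMono_succ)
      simp only [Matrix.of_apply]
      split_ifs
      exacts [S.prod_mem fun k _ => hs k, S.zero_mem]

theorem of_production {P : ℕ → ℕ → R} (hP : IsTP S P)
    (zero_row : ∀ k, M 0 k = if k = 0 then 1 else 0)
    (succ_row : ∀ n k, ∀ᶠ K in atTop, M (n + 1) k = ∑ j ∈ Finset.range K, M n j * P j k) :
    IsTP S M := by
  intro r
  induction r with
  | zero => simp
  | succ r ih =>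
    intro row
    obtain ⟨n, hn⟩ : ∃ n, row 0 = n := ⟨_, rfl⟩
    induction n generalizing row with
    | zero =>
      intro col hrow hcol
      have first_row (j : Fin r) : M (row 0) (col j.succ) = 0 := by
        rw [hn, zero_row, if_neg (by have := lt_of_strictMono_succ hcol j; omega)]
      rw [det_eq_of_first_row_eq_zero _ first_row]
      refine S.mul_mem ?_ <| ih (row ∘ Fin.succ) (col ∘ Fin.succ)
        (hrow.comp Fin.strictMono_succ) (hcol.comp Fin.strictMono_succ)
      rw [Matrix.of_apply, hn, zero_row]
      split_ifs
      exacts [S.one_mem, S.zero_mem]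
    | succ n ih_row =>
      intro col hrow hcol
      have row_pos (i : Fin (r + 1)) : row i - 1 + 1 = row i := by
        have := hrow.monotone (Fin.zero_le i)
        omega
      refine det_sum_mul_mem (A := M) (B := P) (row := fun i => row i - 1)
        (fun g hg => ih_row _ (by omega) g (fun i j hij => ?_) hg)
        (fun g hg => hP _ g col hg hcol) fun i j => ?_
      · have := hrow hij
        have := row_pos i
        omega
      · simpa only [row_pos i] using succ_row (row i - 1) (col j)

end IsTP

/-! ### Totally positive operators on polynomials -/

section Operators

open Polynomial Filter

variable {R : Type*} [CommRing R] {S : Subsemiring R}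

/-- The matrix of a linear operator on polynomials in the monomial basis. Images are rows, so
composition of operators reverses the order of the factors. -/
noncomputable def opMatrix (A : Module.End R R[X]) (i j : ℕ) : R := (A (X ^ i)).coeff j

theorem eventually_coeff_apply_eq_sum (A : Module.End R R[X]) (f : R[X]) (j : ℕ) :
    ∀ᶠ K in atTop, (A f).coeff j = ∑ k ∈ Finset.range K, f.coeff k * opMatrix A k j := by
  filter_upwards [eventually_gt_atTop f.natDegree] with K hK
  conv_lhs => rw [f.as_sum_range' K hK]
  simp only [map_sum, finsetSum_coeff, ← C_mul_X_pow_eq_monomial, ← smul_eq_C_mul, map_smul,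
    coeff_smul, smul_eq_mul, opMatrix]

theorem end_ext_X_pow {A B : Module.End R R[X]} (h : ∀ n, A (X ^ n) = B (X ^ n)) : A = B :=
  (basisMonomials R).ext fun n => by
    simpa only [coe_basisMonomials, monomial_one_right_eq_X_pow] using h n

namespace IsTP

variable {A B : Module.End R R[X]}

theorem opMatrix_mul (hA : IsTP S (opMatrix A)) (hB : IsTP S (opMatrix B)) :
    IsTP S (opMatrix (A * B)) :=
  hB.mul hA fun i j => eventually_coeff_apply_eq_sum A (B (X ^ i)) j

theorem opMatrix_one : IsTP S (opMatrix (1 : Module.End R R[X])) := by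
  convert! bidiagonal (fun _ => S.one_mem) (fun _ => S.zero_mem) using 1
  ext i j
  simp [opMatrix, coeff_X_pow]

theorem opMatrix_pow (hA : IsTP S (opMatrix A)) (n : ℕ) : IsTP S (opMatrix (A ^ n)) := by
  induction n with
  | zero => exact opMatrix_one
  | succ n ih => exact pow_succ A n ▸ ih.opMatrix_mul hA

theorem coeff_iterate (hA : IsTP S (opMatrix A)) : IsTP S fun n k => ((A ^ n) 1).coeff k := by
  refine of_production hA (fun k => by simp [coeff_one]) fun n k => ?_
  simpa only [pow_succ', Module.End.mul_apply] using eventually_coeff_apply_eq_sum A ((A ^ n) 1) k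

-- `⟨e₀, A ^ (i + j) e₀⟩` splits as the product of the matrices `A ^ i e₀` and `(Aᵀ) ^ j e₀`.
theorem hankel_iterate (hA : IsTP S (opMatrix A)) :
    IsTP S fun i j => ((A ^ (i + j)) 1).coeff 0 := by
  have transpose_iterates : IsTP S fun j k => opMatrix (A ^ j) k 0 := by
    refine of_production hA.transpose (fun k => by simp [opMatrix, coeff_X_pow, eq_comm])
      fun n k => ?_
    filter_upwards [eventually_coeff_apply_eq_sum (A ^ n) (A (X ^ k)) 0] with K hK
    rw [opMatrix, pow_succ, Module.End.mul_apply, hK]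
    exact Finset.sum_congr rfl fun j _ => mul_comm _ _
  refine hA.coeff_iterate.mul transpose_iterates.transpose fun i j => ?_
  simpa only [add_comm i j, pow_add, Module.End.mul_apply] using
    eventually_coeff_apply_eq_sum (A ^ j) ((A ^ i) 1) 0

end IsTP

/-- The operator `1 - β D` on polynomials, with `D` the derivative. -/
noncomputable def oneSubDeriv (β : R) : Module.End R R[X] := 1 - β • derivative

/-- The image of `X ^ n` under `(1 - β D)⁻¹`. -/
noncomputable def resolventPoly (β : R) : ℕ → R[X]
  | 0 => 1
  | n + 1 => X ^ (n + 1) + ((n + 1 : R) * β) • resolventPoly β n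

/-- The operator `(1 - β D)⁻¹` on polynomials, given by its values on monomials. -/
noncomputable def derivResolvent (β : R) : Module.End R R[X] :=
  (basisMonomials R).constr R (resolventPoly β)

theorem derivResolvent_X_pow (β : R) (n : ℕ) : derivResolvent β (X ^ n) = resolventPoly β n := by
  simpa only [derivResolvent, coe_basisMonomials, monomial_one_right_eq_X_pow] using
    (basisMonomials R).constr_basis R (resolventPoly β) n

theorem derivResolvent_pow_one (β : R) (n : ℕ) : (derivResolvent β ^ n) 1 = 1 := by
  induction n with
  | zero => rfl
  | succ n ih =>
    rw [pow_succ', Module.End.mul_apply, ih]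
    exact derivResolvent_X_pow β 0

theorem oneSubDeriv_one (β : R) : oneSubDeriv β 1 = 1 := by
  simp [oneSubDeriv]

theorem oneSubDeriv_X_pow_succ (β : R) (n : ℕ) :
    oneSubDeriv β (X ^ (n + 1)) = X ^ (n + 1) - ((n + 1 : R) * β) • X ^ n := by
  simp only [oneSubDeriv, LinearMap.sub_apply, Module.End.one_apply, LinearMap.smul_apply,
    derivative_X_pow, smul_eq_C_mul, C_mul, Nat.add_sub_cancel, Nat.cast_add, Nat.cast_one]
  ring

theorem oneSubDeriv_mul_derivResolvent (β : R) : oneSubDeriv β * derivResolvent β = 1 := by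
  refine end_ext_X_pow fun n => ?_
  rw [Module.End.mul_apply, derivResolvent_X_pow, Module.End.one_apply]
  induction n with
  | zero => exact oneSubDeriv_one β
  | succ n ih => rw [resolventPoly, map_add, map_smul, ih, oneSubDeriv_X_pow_succ, sub_add_cancel]

theorem derivResolvent_mul_oneSubDeriv (β : R) : derivResolvent β * oneSubDeriv β = 1 := by
  refine end_ext_X_pow fun n => ?_
  rw [Module.End.mul_apply, Module.End.one_apply]
  cases n with
  | zero =>
    rw [pow_zero, oneSubDeriv_one, ← pow_zero X, derivResolvent_X_pow, resolventPoly, pow_zero]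
  | succ n =>
    rw [oneSubDeriv_X_pow_succ, map_sub, map_smul, derivResolvent_X_pow, derivResolvent_X_pow,
      resolventPoly, add_sub_cancel_right]

theorem coeff_resolventPoly (β : R) (n k : ℕ) :
    (resolventPoly β n).coeff k = if k ≤ n then ∏ i ∈ Finset.Ioc k n, (i * β : R) else 0 := by
  induction n with
  | zero => cases k <;> simp [resolventPoly, coeff_one]
  | succ n ih =>
    rw [resolventPoly, coeff_add, coeff_smul, ih, coeff_X_pow, smul_eq_mul]
    rcases lt_trichotomy k (n + 1) with h | rfl | h
    · rw [if_neg h.ne, if_pos (by omega), if_pos h.le,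
        Finset.prod_Ioc_succ_top (by omega), zero_add, mul_comm, Nat.cast_succ]
    · simp
    · rw [if_neg h.ne', if_neg (by omega), if_neg (by omega), mul_zero, add_zero]

theorem isTP_derivResolvent {β : R} (hβ : β ∈ S) : IsTP S (opMatrix (derivResolvent β)) := by
  convert! IsTP.prod_Ioc fun i => S.mul_mem (natCast_mem S i) hβ using 1
  ext n k
  rw [opMatrix, derivResolvent_X_pow, coeff_resolventPoly]

/-- Multiplication by `c (X + lam)`. -/
noncomputable def mulAffine (c lam : R) : Module.End R R[X] :=
  LinearMap.mulLeft R (C c * (X + C lam))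

theorem isTP_mulAffine {c lam : R} (hc : c ∈ S) (hlam : lam ∈ S) :
    IsTP S (opMatrix (mulAffine c lam)) := by
  convert! IsTP.bidiagonal (fun _ => S.mul_mem hc hlam) (fun _ => hc) using 1
  ext i j
  rw [opMatrix, mulAffine, LinearMap.mulLeft_apply, mul_assoc, add_mul, ← pow_succ', coeff_C_mul,
    coeff_add, coeff_C_mul, coeff_X_pow, coeff_X_pow]
  rcases eq_or_ne j i with rfl | h
  · simp
  · simp [h]

theorem oneSubDeriv_mul_mulAffine (β c lam : R) :
    oneSubDeriv β * mulAffine c lam = mulAffine c lam * oneSubDeriv β - (c * β) • 1 := by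
  refine LinearMap.ext fun f => ?_
  simp only [Module.End.mul_apply, LinearMap.sub_apply, LinearMap.smul_apply, Module.End.one_apply,
    oneSubDeriv, mulAffine, LinearMap.mulLeft_apply, derivative_mul, derivative_C, derivative_add,
    derivative_X, smul_eq_C_mul, C_mul]
  ring

end Operators

/-! ### Ladder relations -/

section Ladder

variable {R A : Type*} [CommRing R] [Ring A] [Algebra R A] {M V E N P Q : A} {b s t : R}

theorem semiconjBy_shift_mul (hP : SemiconjBy P N (N + s • 1)) (hQ : SemiconjBy Q N (N + t • 1)) :
    SemiconjBy (P * Q) N (N + (s + t) • 1) := by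
  have shifted : SemiconjBy P (N + t • 1) (N + s • 1 + t • 1) :=
    hP.add_right ((Commute.one_right P).smul_right t)
  simpa only [add_smul, add_assoc] using shifted.mul_left hQ

theorem semiconjBy_shift_pow (hP : SemiconjBy P N (N + t • 1)) (n : ℕ) :
    SemiconjBy (P ^ n) N (N + (n * t) • 1) := by
  induction n with
  | zero => simp
  | succ n ih => simpa only [pow_succ, Nat.cast_succ, add_one_mul] using semiconjBy_shift_mul ih hP

theorem semiconjBy_raise (hEM : E * M = M * E - b • 1) :
    SemiconjBy M (M * E) (M * E + b • 1) := by
  rw [SemiconjBy, add_mul, mul_assoc M E M, hEM, mul_sub, smul_mul_assoc, mul_smul_comm, one_mul,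
    mul_one, sub_add_cancel]

theorem semiconjBy_resolvent (hVE : V * E = 1) (hEV : E * V = 1)
    (hEM : E * M = M * E - b • 1) : SemiconjBy V (M * E) (M * E + b • 1) := by
  have hME : M * E = E * M + b • 1 := by rw [hEM, sub_add_cancel]
  rw [SemiconjBy, add_mul, mul_assoc M E V, hEV, hME, mul_add, ← mul_assoc, hVE, smul_mul_assoc,
    mul_smul_comm, one_mul, one_mul, mul_one, mul_one]

theorem semiconjBy_resolvent_pow_mul (hVE : V * E = 1) (hEV : E * V = 1)
    (hEM : E * M = M * E - b • 1) (a p n : ℕ) :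
    SemiconjBy (V ^ p * (M * V ^ a) ^ n) (M * E) (M * E + (p * b + n * (b + a * b)) • 1) :=
  have hV := semiconjBy_resolvent hVE hEV hEM
  semiconjBy_shift_mul (semiconjBy_shift_pow hV p) <| semiconjBy_shift_pow
    (semiconjBy_shift_mul (semiconjBy_raise hEM) (semiconjBy_shift_pow hV a)) n

end Ladder

/-! ### Row polynomials of the generalized Bessel triangle -/

section RowPolynomial

open Polynomial Filter

variable {R : Type*} [CommRing R] [Algebra ℝ R] {S : Subsemiring R}

/-- The row polynomial `∑ k, T n k * X ^ k` of the generalized Bessel triangle, in a formal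
variable. -/
noncomputable def genBesselPoly (a : ℕ) (d c : ℝ) (b lam : R) (n : ℕ) : R[X] :=
  ∑ k ∈ Finset.range (n + 1), C (genBessel a d c b lam n k) * X ^ k

theorem coeff_genBesselPoly (a : ℕ) (d c : ℝ) (b lam : R) (n k : ℕ) :
    (genBesselPoly a d c b lam n).coeff k = genBessel a d c b lam n k := by
  simp only [genBesselPoly, finsetSum_coeff, coeff_C_mul_X_pow, Finset.sum_ite_eq]
  split_ifs with hk
  · rfl
  · rw [genBessel_eq_zero_of_lt _ _ _ _ _ _ _ (by simpa using hk)]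

theorem eval_genBesselPoly (a : ℕ) (d c : ℝ) (b lam q : R) (n : ℕ) :
    (genBesselPoly a d c b lam n).eval q = genBesselRow a d c b lam q n := by
  simp [genBesselPoly, genBesselRow, eval_finsetSum]

theorem genBesselPoly_zero (a : ℕ) (d c : ℝ) (b lam : R) : genBesselPoly a d c b lam 0 = 1 := by
  simp [genBesselPoly, genBessel]

theorem genBesselPoly_succ (a : ℕ) (d c : ℝ) (b lam : R) (n : ℕ) :
    genBesselPoly a d c b lam (n + 1) =
      (X + C lam) * (C (algebraMap ℝ R c) * genBesselPoly a d c b lam n -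
        C b * derivative (genBesselPoly a d c b lam n)) +
      C (algebraMap ℝ R (a * n + a * d) * b) * genBesselPoly a d c b lam n := by
  ext k
  rw [add_mul]
  cases k with
  | zero =>
    simp only [coeff_genBesselPoly, coeff_add, coeff_sub, coeff_C_mul, coeff_derivative,
      coeff_X_mul_zero, genBessel, Algebra.smul_def, map_add]
    push_cast
    ring
  | succ k =>
    simp only [coeff_genBesselPoly, coeff_add, coeff_sub, coeff_C_mul, coeff_derivative,
      coeff_X_mul, genBessel, Algebra.smul_def, map_add, map_sub, map_one, map_natCast]
    push_cast
    ring

theorem genBesselPoly_succ_eq_apply (a : ℕ) (d c : ℝ) {b β : R} (lam : R)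
    (hβ : algebraMap ℝ R c * β = b) (n : ℕ) :
    genBesselPoly a d c b lam (n + 1) =
      (mulAffine (algebraMap ℝ R c) lam * oneSubDeriv β +
        (algebraMap ℝ R (a * n + a * d) * b) • 1) (genBesselPoly a d c b lam n) := by
  simp only [genBesselPoly_succ, LinearMap.add_apply, Module.End.mul_apply, LinearMap.smul_apply,
    Module.End.one_apply, mulAffine, oneSubDeriv, LinearMap.mulLeft_apply, LinearMap.sub_apply,
    smul_eq_C_mul, ← hβ, C_mul]
  ring

-- The factors `V ^ p (M V ^ a) ^ n`, with `V = (1 - β D)⁻¹` and `M` the multiplication operator,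
-- raise `N = M (1 - β D)` by exactly the multiple of `b` by which the recurrence shifts it.
theorem genBesselPoly_eq_resolvent_apply (a p : ℕ) {d c : ℝ} {b β : R} (lam : R)
    (hd : ((a + 1 : ℕ) : ℝ) * d = p) (hβ : algebraMap ℝ R c * β = b) (n : ℕ) :
    genBesselPoly (a + 1) d c b lam n = (derivResolvent β ^ p *
      (mulAffine (algebraMap ℝ R c) lam * derivResolvent β ^ a) ^ n) 1 := by
  induction n with
  | zero => simp [genBesselPoly_zero, derivResolvent_pow_one]
  | succ n ih =>
    have ladder := semiconjBy_resolvent_pow_mul (derivResolvent_mul_oneSubDeriv β)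
      (oneSubDeriv_mul_derivResolvent β) (hβ ▸ oneSubDeriv_mul_mulAffine β _ lam) a p n
    have shift_eq : algebraMap ℝ R ((a + 1 : ℕ) * n + (a + 1 : ℕ) * d) * b =
        p * b + n * (b + a * b) := by
      rw [hd]
      simp only [map_add, map_mul, map_one, map_natCast, Nat.cast_succ]
      ring
    rw [genBesselPoly_succ_eq_apply _ _ _ _ hβ, ih, shift_eq, ← Module.End.mul_apply, ← ladder.eq]
    simp only [pow_succ, Module.End.mul_apply, oneSubDeriv_one, derivResolvent_pow_one]

theorem genBesselPoly_eq_conj_pow_apply (a p : ℕ) (hp : p ≤ a) {d c : ℝ} {b β : R} (lam : R)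
    (hd : ((a + 1 : ℕ) : ℝ) * d = p) (hβ : algebraMap ℝ R c * β = b) (n : ℕ) :
    genBesselPoly (a + 1) d c b lam n = ((derivResolvent β ^ p *
      mulAffine (algebraMap ℝ R c) lam * derivResolvent β ^ (a - p)) ^ n) 1 := by
  have conj : SemiconjBy (derivResolvent β ^ p)
      (mulAffine (algebraMap ℝ R c) lam * derivResolvent β ^ a)
      (derivResolvent β ^ p * mulAffine (algebraMap ℝ R c) lam * derivResolvent β ^ (a - p)) := by
    rw [SemiconjBy, mul_assoc _ _ (derivResolvent β ^ p), ← pow_add, Nat.sub_add_cancel hp,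
      mul_assoc]
  rw [genBesselPoly_eq_resolvent_apply a p lam hd hβ, (conj.pow_right n).eq,
    Module.End.mul_apply, derivResolvent_pow_one]

theorem taylor_genBesselPoly (a : ℕ) (d c : ℝ) (b lam q : R) (n : ℕ) :
    taylor q (genBesselPoly a d c b lam n) = genBesselPoly a d c b (lam + q) n := by
  induction n with
  | zero => simp [genBesselPoly_zero]
  | succ n ih =>
    have taylor_derivative (f : R[X]) : taylor q (derivative f) = derivative (taylor q f) := by
      simp [taylor_apply, derivative_comp]
    rw [genBesselPoly_succ, genBesselPoly_succ, ← ih, ← taylor_derivative]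
    simp only [map_add, map_sub, taylor_mul, taylor_X, taylor_C]
    ring

theorem genBesselRow_eq_zeroth_column (a : ℕ) (d c : ℝ) (b lam q : R) (n : ℕ) :
    genBesselRow a d c b lam q n = genBessel a d c b (lam + q) n 0 := by
  rw [← eval_genBesselPoly, ← coeff_genBesselPoly, ← taylor_genBesselPoly, taylor_coeff_zero]

theorem algebraMap_mul_inv_mul {c : ℝ} (hc : c ≠ 0) (b : R) :
    algebraMap ℝ R c * (algebraMap ℝ R c⁻¹ * b) = b := by
  rw [← mul_assoc, ← map_mul, mul_inv_cancel₀ hc, map_one, one_mul]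

theorem isTP_genBessel (hS : ∀ x : ℝ, 0 ≤ x → algebraMap ℝ R x ∈ S) {a p : ℕ} (ha : 0 < a)
    {d c : ℝ} (hd : (a : ℝ) * d = p) (hc : 0 < c) {b lam : R} (hb : b ∈ S) (hlam : lam ∈ S) :
    IsTP S (genBessel a d c b lam) := by
  obtain ⟨a, rfl⟩ := Nat.exists_eq_add_of_le' ha
  have hV := isTP_derivResolvent (S.mul_mem (hS c⁻¹ (inv_nonneg.2 hc.le)) hb)
  have iterates := ((isTP_mulAffine (hS c hc.le) hlam).opMatrix_mul
    (hV.opMatrix_pow a)).coeff_iterate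
  refine iterates.mul (hV.opMatrix_pow p) fun i j => ?_
  simpa only [← coeff_genBesselPoly, Module.End.mul_apply,
    genBesselPoly_eq_resolvent_apply a p lam hd (algebraMap_mul_inv_mul hc.ne' b)] using
    eventually_coeff_apply_eq_sum _ _ j

theorem isTP_hankel_genBessel (hS : ∀ x : ℝ, 0 ≤ x → algebraMap ℝ R x ∈ S) {a p : ℕ}
    (hp : p < a) {d c : ℝ} (hd : (a : ℝ) * d = p) (hc : 0 < c) {b lam : R}
    (hb : b ∈ S) (hlam : lam ∈ S) : IsTP S fun i j => genBessel a d c b lam (i + j) 0 := by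
  obtain ⟨a, rfl⟩ := Nat.exists_eq_add_of_le' (Nat.zero_lt_of_lt hp)
  have hV := isTP_derivResolvent (S.mul_mem (hS c⁻¹ (inv_nonneg.2 hc.le)) hb)
  simpa only [← genBesselPoly_eq_conj_pow_apply a p (Nat.lt_succ_iff.1 hp) lam hd
    (algebraMap_mul_inv_mul hc.ne' b), coeff_genBesselPoly] using
    (((hV.opMatrix_pow p).opMatrix_mul (isTP_mulAffine (hS c hc.le) hlam)).opMatrix_mul
      (hV.opMatrix_pow (a - p))).hankel_iterate

end RowPolynomial

/-! ### Hankel determinants and log-convexity -/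

section LogConvex

variable {R : Type*} [CommRing R]

/-- The Hankel determinant of order `r` of the sequence `α`, starting at the term `α n`. -/
def hankelDet (α : ℕ → R) (r n : ℕ) : R :=
  Matrix.det (Matrix.of fun i j : Fin r => α (n + i + j))

theorem IsTP.hankelDet_mem {S : Subsemiring R} {α : ℕ → R} (h : IsTP S fun i j => α (i + j))
    (r n : ℕ) : hankelDet α r n ∈ S :=
  h r (fun i => n + i) (fun j => j) (fun _ _ hij => Nat.add_lt_add_left hij n) fun _ _ hij => hij

theorem hankelDet_one (α : ℕ → R) (n : ℕ) : hankelDet α 1 n = α n := by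
  simp [hankelDet]

theorem logConvexOp_eq_hankelDet (α : ℕ → R) : logConvexOp α = hankelDet α 2 := by
  ext n
  simp [hankelDet, logConvexOp, Matrix.det_fin_two, add_assoc, sq]

theorem hankelDet_three (α : ℕ → R) (n : ℕ) :
    hankelDet α 3 n = α n * (α (n + 2) * α (n + 4) - α (n + 3) ^ 2)
      - α (n + 1) * (α (n + 1) * α (n + 4) - α (n + 2) * α (n + 3))
      + α (n + 2) * (α (n + 1) * α (n + 3) - α (n + 2) ^ 2) := by
  simp only [hankelDet, Matrix.det_fin_three, Matrix.of_apply, Fin.val_zero, Fin.val_one,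
    Fin.val_two, add_assoc, Nat.reduceAdd, add_zero]
  ring

-- The Desnanot–Jacobi identity for the Hankel matrix of order four.
theorem hankelDet_three_mul_sub_sq (α : ℕ → R) (n : ℕ) :
    hankelDet α 3 n * hankelDet α 3 (n + 2) - hankelDet α 3 (n + 1) ^ 2 =
      hankelDet α 2 (n + 2) * hankelDet α 4 n := by
  simp only [hankelDet, Matrix.det_succ_row_zero (n := 3), Matrix.det_fin_three,
    Matrix.det_fin_two, Matrix.of_apply, Matrix.submatrix_apply, Fin.sum_univ_four, Fin.succAbove,
    Fin.reduceSucc, Fin.reduceCastSucc, Fin.reduceLT, Fin.isValue, Fin.coe_ofNat_eq_mod,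
    Nat.reduceMod, Nat.reduceAdd, ↓reduceIte, add_assoc, add_zero]
  ring

theorem logConvexOp_iterate_two (α : ℕ → R) (n : ℕ) :
    logConvexOp^[2] α n = α (n + 2) * hankelDet α 3 n := by
  simp only [Function.iterate_succ, Function.iterate_zero, Function.comp_apply, id, logConvexOp,
    hankelDet_three, add_assoc, Nat.reduceAdd]
  ring

theorem logConvexOp_iterate_three (α : ℕ → R) (n : ℕ) :
    logConvexOp^[3] α n = hankelDet α 2 (n + 2) *
      (α (n + 2) * α (n + 4) * hankelDet α 4 n + hankelDet α 3 (n + 1) ^ 2) := by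
  rw [Function.iterate_succ_apply', logConvexOp, logConvexOp_iterate_two,
    logConvexOp_iterate_two, logConvexOp_iterate_two]
  have order_two : hankelDet α 2 (n + 2) = α (n + 2) * α (n + 4) - α (n + 3) ^ 2 := by
    rw [← logConvexOp_eq_hankelDet, logConvexOp]
  linear_combination α (n + 2) * α (n + 4) * hankelDet_three_mul_sub_sq α n -
    hankelDet α 3 (n + 1) ^ 2 * order_two

theorem IsTP.logConvexOp_iterate_mem {S : Subsemiring R} {α : ℕ → R}
    (h : IsTP S fun i j => α (i + j)) (m : ℕ) (hm : m ≤ 3) (n : ℕ) :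
    logConvexOp^[m] α n ∈ S := by
  have term_mem (n : ℕ) : α n ∈ S := hankelDet_one α n ▸ h.hankelDet_mem 1 n
  interval_cases m
  · exact term_mem n
  · rw [Function.iterate_one, logConvexOp_eq_hankelDet]
    exact h.hankelDet_mem 2 n
  · rw [logConvexOp_iterate_two]
    exact S.mul_mem (term_mem _) (h.hankelDet_mem 3 n)
  · rw [logConvexOp_iterate_three]
    exact S.mul_mem (h.hankelDet_mem 2 _) <| S.add_mem
      (S.mul_mem (S.mul_mem (term_mem _) (term_mem _)) (h.hankelDet_mem 4 n))
      (S.pow_mem (h.hankelDet_mem 3 _) 2)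

end LogConvex

/-! ### Polynomials with nonnegative coefficients -/

section NonnegCoeffs

open MvPolynomial

variable {σ : Type*}

/-- The polynomials with nonnegative coefficients, as a subsemiring. -/
def nonnegCoeffsSubsemiring (σ : Type*) : Subsemiring (MvPolynomial σ ℝ) where
  carrier := {P | NonnegCoeffs P}
  mul_mem' {P Q} hP hQ m := by
    classical
    rw [coeff_mul]
    exact Finset.sum_nonneg fun x _ => mul_nonneg (hP _) (hQ _)
  one_mem' m := by
    classical
    rw [coeff_one]
    split_ifs
    exacts [zero_le_one, le_rfl]
  add_mem' {P Q} hP hQ m := coeff_add m P Q ▸ add_nonneg (hP m) (hQ m)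
  zero_mem' m := (coeff_zero m).ge

theorem algebraMap_mem_nonnegCoeffsSubsemiring (x : ℝ) (hx : 0 ≤ x) :
    algebraMap ℝ (MvPolynomial σ ℝ) x ∈ nonnegCoeffsSubsemiring σ := by
  classical
  intro m
  rw [algebraMap_eq, coeff_C]
  split_ifs
  exacts [hx, le_rfl]

theorem X_mem_nonnegCoeffsSubsemiring (i : σ) :
    (X i : MvPolynomial σ ℝ) ∈ nonnegCoeffsSubsemiring σ := by
  classical
  intro m
  rw [coeff_X]
  split_ifs
  exacts [zero_le_one, le_rfl]

theorem coeffTP_iff_isTP {M : ℕ → ℕ → MvPolynomial σ ℝ} :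
    CoeffTP M ↔ IsTP (nonnegCoeffsSubsemiring σ) M :=
  Iff.rfl

theorem IsTP.coeffLogConvex_three {α : ℕ → MvPolynomial σ ℝ}
    (h : IsTP (nonnegCoeffsSubsemiring σ) fun i j => α (i + j)) : CoeffLogConvex 3 α :=
  h.logConvexOp_iterate_mem

variable {a p : ℕ} {d c : ℝ}

theorem coeffTP_genBessel (ha : 0 < a) (hd : (a : ℝ) * d = p) (hc : 0 < c) (i j : σ) :
    CoeffTP (genBessel a d c (X i : MvPolynomial σ ℝ) (X j)) :=
  coeffTP_iff_isTP.2 <| isTP_genBessel algebraMap_mem_nonnegCoeffsSubsemiring ha hd hc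
    (X_mem_nonnegCoeffsSubsemiring i) (X_mem_nonnegCoeffsSubsemiring j)

theorem coeffSM_coeffLogConvex_genBessel (hp : p < a) (hd : (a : ℝ) * d = p) (hc : 0 < c)
    {b lam : MvPolynomial σ ℝ} (hb : b ∈ nonnegCoeffsSubsemiring σ)
    (hlam : lam ∈ nonnegCoeffsSubsemiring σ) :
    CoeffSM (fun n => genBessel a d c b lam n 0) ∧
      CoeffLogConvex 3 (fun n => genBessel a d c b lam n 0) :=
  have h := isTP_hankel_genBessel algebraMap_mem_nonnegCoeffsSubsemiring hp hd hc hb hlam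
  ⟨coeffTP_iff_isTP.2 h, h.coeffLogConvex_three⟩

end NonnegCoeffs

/-! ### Haviland's theorem on the half-line -/

section Haviland

open Polynomial Filter Topology
open scoped CompactlySupported NNReal

/-- The linear functional `X ^ n ↦ α n` on polynomials. -/
noncomputable def momentFunctional (α : ℕ → ℝ) : ℝ[X] →ₗ[ℝ] ℝ :=
  (basisMonomials ℝ).constr ℝ α

theorem momentFunctional_X_pow (α : ℕ → ℝ) (n : ℕ) : momentFunctional α (X ^ n) = α n := by
  simpa only [momentFunctional, coe_basisMonomials, monomial_one_right_eq_X_pow] using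
    (basisMonomials ℝ).constr_basis ℝ α n

theorem momentFunctional_eq_sum (α : ℕ → ℝ) (P : ℝ[X]) :
    momentFunctional α P = ∑ n ∈ Finset.range (P.natDegree + 1), P.coeff n * α n := by
  conv_lhs => rw [P.as_sum_range, map_sum]
  simp only [← C_mul_X_pow_eq_monomial, ← smul_eq_C_mul, map_smul, momentFunctional_X_pow,
    smul_eq_mul]

/-- Haviland's positivity condition: the functional with moments `α` is nonnegative on the
polynomials that are nonnegative on `[0, ∞)`. -/
def IsMomentPositive (α : ℕ → ℝ) : Prop :=
  ∀ P : ℝ[X], (∀ x, 0 ≤ x → 0 ≤ P.eval x) → 0 ≤ momentFunctional α P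

/-- The cone of pairs `(f, P)` with `f + P ≥ 0` on the half-line. Pairs replace the sums `f + P`
so that the functional on polynomials is well defined on a subspace. -/
noncomputable def nonnegPairCone : PointedCone ℝ (C_c(ℝ≥0, ℝ) × ℝ[X]) where
  carrier := {f | ∀ x : ℝ≥0, 0 ≤ f.1 x + f.2.eval (x : ℝ)}
  add_mem' {f g} hf hg x := by
    simpa [add_add_add_comm] using add_nonneg (hf x) (hg x)
  zero_mem' x := by simp
  smul_mem' r f hf x := by
    have smul_eq : (r • f).1 x + (r • f).2.eval (x : ℝ) = (r : ℝ) * (f.1 x + f.2.eval (x : ℝ)) := by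
      rw [mul_add, ← smul_eq_mul (r : ℝ) (f.2.eval _), ← eval_smul]
      rfl
    simpa only [smul_eq] using mul_nonneg r.2 (hf x)

theorem IsMomentPositive.exists_extension {α : ℕ → ℝ} (h : IsMomentPositive α) :
    ∃ g : C_c(ℝ≥0, ℝ) × ℝ[X] →ₗ[ℝ] ℝ, (∀ P, g (0, P) = momentFunctional α P) ∧
      ∀ f P, (∀ x : ℝ≥0, 0 ≤ f x + P.eval (x : ℝ)) → 0 ≤ g (f, P) := by
  let f₀ : (C_c(ℝ≥0, ℝ) × ℝ[X]) →ₗ.[ℝ] ℝ :=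
    { domain := (⊥ : Submodule ℝ C_c(ℝ≥0, ℝ)).prod ⊤
      toFun := (momentFunctional α ∘ₗ LinearMap.snd ℝ _ _) ∘ₗ Submodule.subtype _ }
  have nonneg_of_mem : ∀ x : f₀.domain,
      (x : C_c(ℝ≥0, ℝ) × ℝ[X]) ∈ nonnegPairCone → 0 ≤ f₀ x := by
    rintro ⟨⟨f, P⟩, hfP⟩ hx
    obtain rfl : f = 0 := by simpa [f₀] using hfP
    refine h P fun x hx0 => ?_
    have hPx : 0 ≤ (0 : ℝ) + P.eval x := hx ⟨x, hx0⟩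
    rwa [zero_add] at hPx
  have exists_add_mem : ∀ y, ∃ x : f₀.domain,
      (x : C_c(ℝ≥0, ℝ) × ℝ[X]) + y ∈ nonnegPairCone := by
    rintro ⟨f, P⟩
    obtain ⟨B, hB⟩ := f.hasCompactSupport.exists_bound_of_continuous f.continuous
    refine ⟨⟨(0, C B - P), by simp [f₀]⟩, fun x => ?_⟩
    have hBx := neg_le_of_abs_le (hB x)
    simp only [Prod.mk_add_mk, zero_add, eval_add, eval_sub, eval_C]
    linarith
  obtain ⟨g, hg, hg_nonneg⟩ := riesz_extension nonnegPairCone f₀ nonneg_of_mem exists_add_mem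
  exact ⟨g, fun P => hg ⟨(0, P), by simp [f₀]⟩, fun f P hf => hg_nonneg (f, P) hf⟩

/-- `x ^ n` cut off continuously between `N` and `N + 1`. -/
noncomputable def truncPow (n N : ℕ) : C_c(ℝ≥0, ℝ) where
  toFun x := (x : ℝ) ^ n * max 0 (min 1 ((N : ℝ) + 1 - (x : ℝ)))
  continuous_toFun := by fun_prop
  hasCompactSupport' := by
    refine HasCompactSupport.intro (isCompact_Icc (a := (0 : ℝ≥0)) (b := (N + 1 : ℝ≥0)))
      fun x hx => ?_
    have hlt : (N + 1 : ℝ) < x := by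
      exact_mod_cast not_le.1 fun hle => hx ⟨zero_le, hle⟩
    rw [max_eq_left (min_le_of_right_le (by linarith)), mul_zero]

theorem truncPow_apply (n N : ℕ) (x : ℝ≥0) :
    truncPow n N x = (x : ℝ) ^ n * max 0 (min 1 ((N : ℝ) + 1 - (x : ℝ))) := rfl

theorem truncPow_nonneg (n N : ℕ) (x : ℝ≥0) : 0 ≤ truncPow n N x :=
  mul_nonneg (by positivity) (le_max_left _ _)

theorem truncPow_le (n N : ℕ) (x : ℝ≥0) : truncPow n N x ≤ (x : ℝ) ^ n :=
  mul_le_of_le_one_right (by positivity) (max_le zero_le_one (min_le_left _ _))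

theorem truncPow_mono (n : ℕ) (x : ℝ≥0) : Monotone fun N => truncPow n N x := by
  intro N M hNM
  simp only [truncPow_apply]
  gcongr

theorem truncPow_of_le {n N : ℕ} {x : ℝ≥0} (h : (x : ℝ) ≤ N) :
    truncPow n N x = (x : ℝ) ^ n := by
  rw [truncPow_apply, min_eq_left (by linarith), max_eq_right zero_le_one, mul_one]

theorem tendsto_truncPow (n : ℕ) (x : ℝ≥0) :
    Tendsto (fun N => truncPow n N x) atTop (𝓝 ((x : ℝ) ^ n)) := by
  obtain ⟨N₀, hN₀⟩ := exists_nat_ge (x : ℝ)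
  refine tendsto_const_nhds.congr' ?_
  filter_upwards [eventually_ge_atTop N₀] with N hN
  rw [truncPow_of_le (hN₀.trans (by exact_mod_cast hN))]

theorem pow_le_truncPow_add (n : ℕ) {N : ℕ} (hN : 0 < N) (x : ℝ≥0) :
    (x : ℝ) ^ n ≤ truncPow n N x + (x : ℝ) ^ (n + 1) / N := by
  have hN' : (0 : ℝ) < N := by exact_mod_cast hN
  rcases le_or_gt (x : ℝ) N with hle | hlt
  · rw [truncPow_of_le hle]
    exact le_add_of_nonneg_right (by positivity)
  · refine le_add_of_nonneg_of_le (truncPow_nonneg n N x) ?_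
    rw [le_div_iff₀ hN', pow_succ]
    gcongr

theorem tendsto_extension_truncPow {α : ℕ → ℝ} {g : C_c(ℝ≥0, ℝ) × ℝ[X] →ₗ[ℝ] ℝ}
    (hg : ∀ P, g (0, P) = momentFunctional α P)
    (hg_nonneg : ∀ f P, (∀ x : ℝ≥0, 0 ≤ f x + P.eval (x : ℝ)) → 0 ≤ g (f, P)) (n : ℕ) :
    Tendsto (fun N => g (truncPow n N, 0)) atTop (𝓝 (α n)) := by
  have g_add : ∀ f P, g (f, P) = g (f, 0) + momentFunctional α P := fun f P => by
    rw [← hg, ← map_add, Prod.mk_add_mk, add_zero, zero_add]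
  have upper : ∀ N, g (truncPow n N, 0) ≤ α n := fun N => by
    have hpos := hg_nonneg (-truncPow n N) (X ^ n) fun x => by
      simpa using truncPow_le n N x
    rw [g_add, momentFunctional_X_pow, ← neg_zero (G := ℝ[X]), ← Prod.neg_mk, map_neg] at hpos
    linarith
  have lower : ∀ N : ℕ, 0 < N → α n - α (n + 1) / N ≤ g (truncPow n N, 0) := fun N hN => by
    have hpos := hg_nonneg (truncPow n N) ((N : ℝ)⁻¹ • X ^ (n + 1) - X ^ n) fun x => by
      simp only [eval_sub, eval_smul, eval_pow, eval_X, smul_eq_mul, inv_mul_eq_div]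
      linarith [pow_le_truncPow_add n hN x]
    rw [g_add, map_sub, map_smul, momentFunctional_X_pow, momentFunctional_X_pow, smul_eq_mul,
      inv_mul_eq_div] at hpos
    linarith
  have lower_tendsto : Tendsto (fun N : ℕ => α n - α (n + 1) / N) atTop (𝓝 (α n)) := by
    simpa using (tendsto_const_div_atTop_nhds_zero_nat (α (n + 1))).const_sub (α n)
  exact tendsto_of_tendsto_of_tendsto_of_le_of_le' lower_tendsto tendsto_const_nhds
    ((eventually_gt_atTop 0).mono lower) (Eventually.of_forall upper)

theorem integrable_and_integral_eq_of_monotone {Ω : Type*} [MeasurableSpace Ω] {μ : Measure Ω}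
    {f : ℕ → Ω → ℝ} {F : Ω → ℝ} {L : ℝ} (hf : ∀ N, Integrable (f N) μ)
    (hf_nonneg : ∀ N x, 0 ≤ f N x) (hf_mono : ∀ x, Monotone fun N => f N x)
    (hF : ∀ x, Tendsto (fun N => f N x) atTop (𝓝 (F x)))
    (hL : Tendsto (fun N => ∫ x, f N x ∂μ) atTop (𝓝 L)) :
    Integrable F μ ∧ ∫ x, F x ∂μ = L := by
  have hF_nonneg : ∀ x, 0 ≤ F x := fun x => ge_of_tendsto' (hF x) fun N => hf_nonneg N x
  have lintegral_eq : ∫⁻ x, ENNReal.ofReal (F x) ∂μ = ENNReal.ofReal L := by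
    refine tendsto_nhds_unique ?_ (ENNReal.tendsto_ofReal hL)
    simp only [fun N => ofReal_integral_eq_lintegral_ofReal (hf N)
      (Eventually.of_forall (hf_nonneg N))]
    exact lintegral_tendsto_of_tendsto_of_monotone
      (fun N => (hf N).aestronglyMeasurable.aemeasurable.ennreal_ofReal)
      (Eventually.of_forall fun x N M hNM => ENNReal.ofReal_le_ofReal (hf_mono x hNM))
      (Eventually.of_forall fun x => ENNReal.tendsto_ofReal (hF x))
  have hF_int : Integrable F μ := by
    refine ⟨aestronglyMeasurable_of_tendsto_ae _ (fun N => (hf N).aestronglyMeasurable)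
      (Eventually.of_forall hF), ?_⟩
    rw [hasFiniteIntegral_iff_ofReal (Eventually.of_forall hF_nonneg), lintegral_eq]
    exact ENNReal.ofReal_lt_top
  exact ⟨hF_int, tendsto_nhds_unique (integral_tendsto_of_tendsto_of_monotone hf hF_int
    (Eventually.of_forall hf_mono) (Eventually.of_forall hF)) hL⟩

theorem isStieltjesMoment_integral_pow {Ω : Type*} [MeasurableSpace Ω] {μ : Measure Ω}
    {Y : Ω → ℝ} (hY : AEMeasurable Y μ) (hY_nonneg : ∀ᵐ ω ∂μ, 0 ≤ Y ω)
    (hY_int : ∀ n : ℕ, Integrable (fun ω => Y ω ^ n) μ) :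
    IsStieltjesMoment fun n => ∫ ω, Y ω ^ n ∂μ := by
  have hpow : ∀ n : ℕ, AEStronglyMeasurable (fun x : ℝ => x ^ n) (μ.map Y) := fun n =>
    (continuous_pow n).aestronglyMeasurable
  refine ⟨μ.map Y, ?_, fun n => ⟨?_, integral_map hY (hpow n)⟩⟩
  · rw [Measure.map_apply_of_aemeasurable hY measurableSet_Iio]
    exact measure_eq_zero_iff_ae_notMem.2 (hY_nonneg.mono fun ω hω => not_lt.2 hω)
  · exact (integrable_map_measure (hpow n) hY).2 (hY_int n)

/-- Haviland's theorem: extend the functional to compactly supported functions, represent it there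
by a measure, and recover the moments from truncated powers. -/
theorem IsMomentPositive.isStieltjesMoment {α : ℕ → ℝ} (h : IsMomentPositive α) :
    IsStieltjesMoment α := by
  obtain ⟨g, hg, hg_nonneg⟩ := h.exists_extension
  let Λ : C_c(ℝ≥0, ℝ) →ₚ[ℝ] ℝ := PositiveLinearMap.mk₀ (g ∘ₗ LinearMap.inl ℝ _ _)
    fun f hf => hg_nonneg f 0 fun x => by simpa using hf x
  let ν := RealRMK.rieszMeasure Λ
  have integral_eq : ∀ f : C_c(ℝ≥0, ℝ), ∫ x, f x ∂ν = g (f, 0) := fun f =>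
    RealRMK.integral_rieszMeasure Λ f
  have moments : ∀ n, Integrable (fun x : ℝ≥0 => (x : ℝ) ^ n) ν ∧ ∫ x : ℝ≥0, (x : ℝ) ^ n ∂ν = α n :=
    fun n => integrable_and_integral_eq_of_monotone (fun N => (truncPow n N).integrable)
      (truncPow_nonneg n) (truncPow_mono n) (tendsto_truncPow n)
      (by simpa only [integral_eq] using tendsto_extension_truncPow hg hg_nonneg n)
  rw [show α = fun n => ∫ x : ℝ≥0, (x : ℝ) ^ n ∂ν from funext fun n => (moments n).2.symm]
  exact isStieltjesMoment_integral_pow NNReal.continuous_coe.measurable.aemeasurable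
    (Eventually.of_forall fun x => x.2) fun n => (moments n).1

end Haviland

/-! ### Moment positivity from discrete approximation -/

section DiscreteApproximation

open Polynomial Filter Topology

theorem IsMomentPositive.const_mul {α : ℕ → ℝ} (h : IsMomentPositive α) {C : ℝ} (hC : 0 ≤ C) :
    IsMomentPositive fun n => C * α n := by
  intro P hP
  simp only [momentFunctional_eq_sum, mul_left_comm _ C, ← Finset.mul_sum]
  rw [← momentFunctional_eq_sum]
  exact mul_nonneg hC (h P hP)

theorem IsMomentPositive.pow_mul {α : ℕ → ℝ} (h : IsMomentPositive α) {r : ℝ} (hr : 0 ≤ r) :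
    IsMomentPositive fun n => r ^ n * α n := by
  intro P hP
  have functional_eq : momentFunctional (fun n => r ^ n * α n) =
      momentFunctional α ∘ₗ (aeval (r • X : ℝ[X])).toLinearMap := by
    refine (basisMonomials ℝ).ext fun n => ?_
    simp only [coe_basisMonomials, monomial_one_right_eq_X_pow, momentFunctional_X_pow,
      LinearMap.comp_apply, AlgHom.toLinearMap_apply, map_pow, aeval_X, _root_.smul_pow, map_smul,
      smul_eq_mul]
  rw [functional_eq]
  refine h (P.comp (r • X)) fun x hx => ?_
  rw [eval_comp, eval_smul, eval_X]
  exact hP _ (mul_nonneg hr hx)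

theorem isMomentPositive_pow {x : ℝ} (hx : 0 ≤ x) : IsMomentPositive fun n => x ^ n := by
  intro P hP
  rw [momentFunctional_eq_sum, ← eval_eq_sum_range]
  exact hP x hx

theorem natCast_mul_descFactorial (m n : ℕ) :
    (m : ℝ) * m.descFactorial n = m.descFactorial (n + 1) + n * m.descFactorial n := by
  rw [Nat.descFactorial_succ]
  rcases le_or_gt n m with h | h
  · push_cast [h]; ring
  · simp [Nat.descFactorial_eq_zero_iff_lt.2 h]

/-- If a measure on the lattice of step `1 / (N + 1)` has `n`-th factorial moment `μ n`, then
`mixedMoment μ N k n` is its moment of `x ^ k` times the `n`-th factorial power of `x`. -/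
noncomputable def mixedMoment (μ : ℕ → ℝ) (N : ℕ) : ℕ → ℕ → ℝ
  | 0, n => μ n
  | k + 1, n => mixedMoment μ N k (n + 1) + n / (N + 1) * mixedMoment μ N k n

theorem tendsto_mixedMoment (μ : ℕ → ℝ) (k : ℕ) : ∀ n,
    Tendsto (fun N => mixedMoment μ N k n) atTop (𝓝 (μ (k + n))) := by
  induction k with
  | zero => intro n; simp [mixedMoment]
  | succ k ih =>
    intro n
    have step_tendsto : Tendsto (fun N : ℕ => (n : ℝ) / (N + 1)) atTop (𝓝 0) := by
      simpa [div_eq_mul_inv] using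
        (tendsto_one_div_add_atTop_nhds_zero_nat (𝕜 := ℝ)).const_mul (n : ℝ)
    simpa [mixedMoment, add_assoc, add_comm 1 n] using (ih (n + 1)).add (step_tendsto.mul (ih n))

theorem hasSum_mixedMoment {μ w : ℕ → ℝ} {N : ℕ}
    (h : ∀ n : ℕ, HasSum (fun m : ℕ => (m.descFactorial n : ℝ) / (N + 1) ^ n * w m) (μ n))
    (k : ℕ) : ∀ n : ℕ, HasSum (fun m : ℕ => ((m : ℝ) / (N + 1)) ^ k *
      ((m.descFactorial n : ℝ) / (N + 1) ^ n * w m)) (mixedMoment μ N k n) := by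
  induction k with
  | zero => simpa [mixedMoment] using h
  | succ k ih =>
    intro n
    convert! (ih (n + 1)).add ((ih n).mul_left ((n : ℝ) / (N + 1))) using 2 with m
    have mul_factorial : (m : ℝ) / (N + 1) * ((m.descFactorial n : ℝ) / (N + 1) ^ n) =
        (m.descFactorial (n + 1) : ℝ) / (N + 1) ^ (n + 1) +
        n / (N + 1) * ((m.descFactorial n : ℝ) / (N + 1) ^ n) := by
      rw [div_mul_div_comm, natCast_mul_descFactorial, pow_succ]
      field_simp
    rw [pow_succ]
    linear_combination ((m : ℝ) / (N + 1)) ^ k * w m * mul_factorial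

/-- The measures on lattices of step `1 / (N + 1)` with weights `w N` share the factorial moments
`μ`; their ordinary moments therefore converge to `μ` as `N → ∞`. -/
theorem isMomentPositive_of_hasSum_descFactorial {μ : ℕ → ℝ} {w : ℕ → ℕ → ℝ}
    (hw : ∀ N m, 0 ≤ w N m)
    (h : ∀ N n : ℕ, HasSum (fun m : ℕ => (m.descFactorial n : ℝ) / (N + 1) ^ n * w N m) (μ n)) :
    IsMomentPositive μ := by
  intro P hP
  have functional_tendsto : Tendsto (fun N => ∑ k ∈ Finset.range (P.natDegree + 1),
      P.coeff k * mixedMoment μ N k 0) atTop (𝓝 (momentFunctional μ P)) := by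
    rw [momentFunctional_eq_sum]
    exact tendsto_finsetSum _ fun k _ => (tendsto_mixedMoment μ k 0).const_mul _
  refine ge_of_tendsto' functional_tendsto fun N => ?_
  have hasSum_eval : HasSum (fun m : ℕ => P.eval ((m : ℝ) / (N + 1)) * w N m)
      (∑ k ∈ Finset.range (P.natDegree + 1), P.coeff k * mixedMoment μ N k 0) := by
    simpa [eval_eq_sum_range, Finset.sum_mul, mul_assoc] using
      hasSum_sum fun k (_ : k ∈ Finset.range (P.natDegree + 1)) =>
        (hasSum_mixedMoment (h N) k 0).mul_left (P.coeff k)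
  exact hasSum_eval.nonneg fun m => mul_nonneg (hP _ (by positivity)) (hw N m)

end DiscreteApproximation

/-! ### Moment positivity of the zeroth column -/

section ZerothColumn

open Polynomial Filter Topology

variable {a : ℕ} {d c b y : ℝ}

theorem genBessel_nonneg_of_lam_eq_zero (ha : 0 < a) (hd : 0 ≤ d) (hc : 0 ≤ c) (hb : 0 ≤ b)
    (n : ℕ) : ∀ k, 0 ≤ genBessel a d c b 0 n k := by
  induction n with
  | zero => rintro (_ | _) <;> simp [genBessel]
  | succ n ih =>
    rintro (_ | k)
    · have hT := ih 0
      simp only [genBessel, smul_eq_mul]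
      ring_nf
      positivity
    · have hstep : 0 ≤ ((a : ℝ) * n - (k + 1) + a * d) * b * genBessel a d c b 0 n (k + 1) := by
        rcases lt_or_ge n (k + 1) with hlt | hle
        · rw [genBessel_eq_zero_of_lt _ _ _ _ _ _ _ hlt, mul_zero]
        · have hkn : (k + 1 : ℝ) ≤ a * n := by
            exact_mod_cast hle.trans (Nat.le_mul_of_pos_left n ha)
          have hfac : 0 ≤ (a : ℝ) * n - (k + 1) + a * d := by
            linarith [mul_nonneg (Nat.cast_nonneg (α := ℝ) a) hd]
          exact mul_nonneg (mul_nonneg hfac hb) (ih _)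
      simpa [genBessel] using add_nonneg (mul_nonneg hc (ih k)) hstep

/-- The functions `w ^ (-n - d) * exp (-(c * y / b) * w ^ (1 / a)) * Q n (y * w ^ (1 / a))`, with
`Q n` the row polynomial at `lam = 0`: up to constants, the derivatives of the one with `n = 0`. -/
noncomputable def besselKernel (a : ℕ) (d c b y : ℝ) (n : ℕ) (w : ℂ) : ℂ :=
  w ^ (-(n + d) : ℂ) * Complex.exp (-(c * y / b) * w ^ (1 / a : ℂ)) *
    aeval (y * w ^ (1 / a : ℂ)) (genBesselPoly a d c b (0 : ℝ) n)

/-- `besselKernel` on the positive half-line, where it is real. -/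
noncomputable def realBesselKernel (a : ℕ) (d c b y : ℝ) (n : ℕ) (w : ℝ) : ℝ :=
  w ^ (-(n + d)) * Real.exp (-(c * y / b) * w ^ (1 / a : ℝ)) *
    (genBesselPoly a d c b (0 : ℝ) n).eval (y * w ^ (1 / a : ℝ))

theorem besselKernel_ofReal (n : ℕ) {w : ℝ} (hw : 0 ≤ w) :
    besselKernel a d c b y n w = realBesselKernel a d c b y n w := by
  have hroot : (w : ℂ) ^ (1 / a : ℂ) = (w ^ (1 / a : ℝ) : ℝ) := by
    rw [Complex.ofReal_cpow hw]
    push_cast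
    rfl
  have haeval := aeval_algebraMap_apply_eq_algebraMap_eval (A := ℂ) (y * w ^ (1 / a : ℝ))
    (genBesselPoly a d c b (0 : ℝ) n)
  simp only [Complex.coe_algebraMap, Complex.ofReal_mul] at haeval
  rw [besselKernel, realBesselKernel, hroot, haeval]
  push_cast [Complex.ofReal_cpow hw]
  rfl

theorem realBesselKernel_one (n : ℕ) :
    realBesselKernel a d c b y n 1 = Real.exp (-(c * y / b)) * genBessel a d c b y n 0 := by
  simp [realBesselKernel, eval_genBesselPoly, genBesselRow_eq_zeroth_column]

theorem realBesselKernel_nonneg (ha : 0 < a) (hd : 0 ≤ d) (hc : 0 ≤ c) (hb : 0 ≤ b) (hy : 0 ≤ y)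
    (n : ℕ) {w : ℝ} (hw : 0 ≤ w) : 0 ≤ realBesselKernel a d c b y n w := by
  refine mul_nonneg (by positivity) ?_
  rw [eval_genBesselPoly, genBesselRow]
  exact Finset.sum_nonneg fun k _ =>
    mul_nonneg (genBessel_nonneg_of_lam_eq_zero ha hd hc hb n k) (by positivity)

theorem hasDerivAt_besselKernel (ha : 0 < a) (hb : b ≠ 0) (n : ℕ) {w : ℂ}
    (hw : w ∈ Complex.slitPlane) :
    HasDerivAt (besselKernel a d c b y n) (-1 / (a * b) * besselKernel a d c b y (n + 1) w) w := by
  have hw0 : w ≠ 0 := Complex.slitPlane_ne_zero hw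
  have ha' : (a : ℂ) ≠ 0 := by exact_mod_cast ha.ne'
  have hb' : (b : ℂ) ≠ 0 := by exact_mod_cast hb
  have hcpow : ∀ s : ℂ, HasDerivAt (fun z : ℂ => z ^ s) (s * w ^ s / w) w := fun s => by
    simpa [Complex.cpow_sub _ _ hw0, mul_div_assoc] using (hasDerivAt_id w).cpow_const (c := s) hw
  have hderiv := ((hcpow (-(n + d))).mul ((hcpow (1 / a)).const_mul (-(c * y / b) : ℂ)).cexp).mul
    (((genBesselPoly a d c b (0 : ℝ) n).hasDerivAt_aeval (y * w ^ (1 / a : ℂ))).comp w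
      ((hcpow (1 / a)).const_mul (y : ℂ)))
  refine hderiv.congr_deriv ?_
  have hexponent : w ^ (-((n + 1 : ℕ) + d) : ℂ) = w ^ (-(n + d) : ℂ) / w := by
    rw [show (-((n + 1 : ℕ) + d) : ℂ) = -(n + d) - 1 by push_cast; ring,
      Complex.cpow_sub _ _ hw0, Complex.cpow_one]
  simp only [besselKernel, hexponent, genBesselPoly_succ, map_add, map_mul, map_sub, aeval_X,
    aeval_C, Function.comp, Pi.mul_apply, C_0, add_zero, Algebra.algebraMap_self,
    RingHom.id_apply, Complex.coe_algebraMap, Complex.ofReal_natCast]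
  generalize w ^ (1 / a : ℂ) = root
  field_simp
  ring

theorem iteratedDeriv_besselKernel (ha : 0 < a) (hb : b ≠ 0) (n j : ℕ) {w : ℂ}
    (hw : w ∈ Complex.slitPlane) :
    iteratedDeriv j (besselKernel a d c b y n) w =
      (-1 / (a * b)) ^ j * besselKernel a d c b y (n + j) w := by
  induction j generalizing w with
  | zero => simp
  | succ j ih =>
    have hlocal : iteratedDeriv j (besselKernel a d c b y n) =ᶠ[𝓝 w]
        fun z => (-1 / (a * b)) ^ j * besselKernel a d c b y (n + j) z :=
      (Complex.isOpen_slitPlane.eventually_mem hw).mono fun z hz => ih hz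
    rw [iteratedDeriv_succ, hlocal.deriv_eq,
      ((hasDerivAt_besselKernel ha hb (n + j) hw).const_mul _).deriv, pow_succ, mul_assoc,
      add_assoc]

/-- The Taylor expansion at `1 + r` is valid at `1`, since the kernel is holomorphic on the disc of
radius `1 + r`. -/
theorem hasSum_realBesselKernel (ha : 0 < a) (hb : b ≠ 0) (n : ℕ) {r : ℝ} (hr : 0 < r) :
    HasSum (fun j : ℕ => (r / (a * b)) ^ j / (j.factorial : ℝ) *
      realBesselKernel a d c b y (n + j) (1 + r)) (realBesselKernel a d c b y n 1) := by
  have hball : Metric.ball ((1 + r : ℝ) : ℂ) (1 + r) ⊆ Complex.slitPlane := fun z hz => by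
    rw [mem_ball_iff_norm'] at hz
    have hre := (Complex.re_le_norm _).trans_lt hz
    rw [Complex.sub_re, Complex.ofReal_re] at hre
    exact Or.inl (by linarith)
  have hone : (1 : ℂ) ∈ Metric.ball ((1 + r : ℝ) : ℂ) (1 + r) := by
    simp [abs_of_pos hr]
  have htaylor := Complex.hasSum_taylorSeries_on_ball (fun z hz =>
    (hasDerivAt_besselKernel (d := d) (c := c) (y := y) ha hb n
      (hball hz)).differentiableAt.differentiableWithinAt) hone
  rw [← Complex.hasSum_ofReal, ← besselKernel_ofReal _ zero_le_one, Complex.ofReal_one]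
  convert! htaylor using 2 with j
  rw [iteratedDeriv_besselKernel ha hb n j (hball (Metric.mem_ball_self (by linarith))),
    besselKernel_ofReal _ (by linarith)]
  have hratio : (r / (a * b) : ℂ) ^ j = (-r) ^ j * (-1 / (a * b)) ^ j := by
    rw [← mul_pow]
    congr 1
    ring
  push_cast
  rw [hratio, show (1 - (1 + r) : ℂ) = -r by ring, smul_eq_mul, smul_eq_mul]
  ring

theorem descFactorial_add_div_factorial (n j : ℕ) :
    ((n + j).descFactorial n : ℝ) / (n + j).factorial = 1 / j.factorial := by
  have hfac := Nat.factorial_mul_descFactorial (Nat.le_add_right n j)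
  rw [Nat.add_sub_cancel_left] at hfac
  rw [div_eq_div_iff (by positivity) (by positivity), one_mul, mul_comm, ← hfac, Nat.cast_mul]

theorem hasSum_descFactorial_realBesselKernel (ha : 0 < a) (hb : b ≠ 0) (n : ℕ) {r : ℝ}
    (hr : 0 < r) :
    HasSum (fun m : ℕ => (m.descFactorial n : ℝ) / r ^ n *
        ((r / (a * b)) ^ m / m.factorial * realBesselKernel a d c b y m (1 + r)))
      ((a * b : ℝ)⁻¹ ^ n * realBesselKernel a d c b y n 1) := by
  have hsupport : ∀ m ∉ Set.range (n + ·), (m.descFactorial n : ℝ) / r ^ n *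
      ((r / (a * b)) ^ m / m.factorial * realBesselKernel a d c b y m (1 + r)) = 0 := by
    intro m hm
    have hmn : m < n := not_le.1 fun hle => hm ⟨m - n, Nat.add_sub_of_le hle⟩
    simp [Nat.descFactorial_eq_zero_iff_lt.2 hmn]
  rw [← (add_right_injective n).hasSum_iff hsupport]
  convert! (hasSum_realBesselKernel ha hb n hr).mul_left ((a * b : ℝ)⁻¹ ^ n) using 2 with j
  have hpow : (r / (a * b)) ^ (n + j) / r ^ n = (a * b : ℝ)⁻¹ ^ n * (r / (a * b)) ^ j := by
    rw [pow_add, div_eq_mul_inv r, mul_pow]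
    field_simp
  calc ((n + j).descFactorial n : ℝ) / r ^ n *
        ((r / (a * b)) ^ (n + j) / (n + j).factorial * realBesselKernel a d c b y (n + j) (1 + r))
      = (r / (a * b)) ^ (n + j) / r ^ n * (((n + j).descFactorial n : ℝ) / (n + j).factorial) *
          realBesselKernel a d c b y (n + j) (1 + r) := by ring
    _ = _ := by rw [hpow, descFactorial_add_div_factorial]; ring

theorem genBessel_zeroth_column_of_b_eq_zero (n : ℕ) : genBessel a d c 0 y n 0 = (c * y) ^ n := by
  induction n with
  | zero => simp [genBessel]
  | succ n ih => simp [genBessel, ih, pow_succ']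

theorem isMomentPositive_genBessel (ha : 0 < a) (hd : 0 ≤ d) (hc : 0 ≤ c) (hb : 0 ≤ b)
    (hy : 0 ≤ y) : IsMomentPositive fun n => genBessel a d c b y n 0 := by
  rcases hb.eq_or_lt with rfl | hb
  · simpa only [genBessel_zeroth_column_of_b_eq_zero] using isMomentPositive_pow (mul_nonneg hc hy)
  have hab : (0 : ℝ) < a * b := by positivity
  have hkernel : IsMomentPositive fun n => (a * b : ℝ)⁻¹ ^ n * realBesselKernel a d c b y n 1 :=
    isMomentPositive_of_hasSum_descFactorial
      (fun N m => mul_nonneg (by positivity)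
        (realBesselKernel_nonneg ha hd hc hb.le hy m (by positivity)))
      fun N n => hasSum_descFactorial_realBesselKernel ha hb.ne' n (r := N + 1) (by positivity)
  convert! (hkernel.pow_mul hab.le).const_mul (Real.exp_nonneg (c * y / b)) using 2 with n
  rw [← mul_assoc (_ ^ n), ← mul_pow, mul_inv_cancel₀ hab.ne', one_pow, one_mul,
    realBesselKernel_one, ← mul_assoc, ← Real.exp_add, add_neg_cancel, Real.exp_zero, one_mul]

end ZerothColumn

/-! ### Preservation of the Stieltjes moment property -/

section Convolution

variable {R : Type*} [CommRing R] [Algebra ℝ R]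

theorem genBessel_mul_pow_succ_sub (a : ℕ) (d c : ℝ) (b lam t : R) (n k : ℕ) :
    genBessel a d c b lam n k * t ^ (n + 1 - k) =
      genBessel a d c b lam n k * t ^ (n - k) * t := by
  rcases le_or_gt k n with hle | hlt
  · rw [Nat.succ_sub hle, pow_succ, mul_assoc]
  · simp only [genBessel_eq_zero_of_lt _ _ _ _ _ _ _ hlt, zero_mul]

theorem genBessel_mul_pow_sub (a : ℕ) (d c : ℝ) (b lam t : R) (n k : ℕ) :
    genBessel a d c b lam n (k + 1) * t ^ (n + 1 - k) =
      genBessel a d c b lam n (k + 1) * t ^ (n - (k + 1)) * t ^ 2 := by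
  rcases le_or_gt (k + 1) n with hle | hlt
  · rw [mul_assoc, ← pow_add, show n - (k + 1) + 2 = n + 1 - k by omega]
  · simp only [genBessel_eq_zero_of_lt _ _ _ _ _ _ _ hlt, zero_mul]

theorem genBessel_mul_mul (a : ℕ) (d c : ℝ) (b lam t : R) (n : ℕ) :
    ∀ k, genBessel a d c (t * b) (t * lam) n k = genBessel a d c b lam n k * t ^ (n - k) := by
  induction n with
  | zero => rintro (_ | k) <;> simp [genBessel]
  | succ n ih =>
    rintro (_ | k)
    · have same := genBessel_mul_pow_succ_sub a d c b lam t n 0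
      have next := genBessel_mul_pow_sub a d c b lam t n 0
      simp only [Nat.sub_zero, zero_add] at same next
      simp only [genBessel, ih, Algebra.smul_def, Nat.sub_zero]
      linear_combination b * lam * next -
        (algebraMap ℝ R (a * n + a * d) * b + algebraMap ℝ R c * lam) * same
    · have same := genBessel_mul_pow_succ_sub a d c b lam t n (k + 1)
      have next := genBessel_mul_pow_sub a d c b lam t n (k + 1)
      simp only [Nat.add_sub_add_right] at same next
      simp only [genBessel, ih, Algebra.smul_def, Nat.add_sub_add_right]
      linear_combination (k + 2) * (b * lam) * next -
        (algebraMap ℝ R (a * n - (k + 1) + a * d) * b + algebraMap ℝ R c * lam) * same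

theorem sum_genBessel_mul_pow_mul_pow (a : ℕ) (d c : ℝ) (b lam s t : R) (n : ℕ) :
    ∑ k ∈ Finset.range (n + 1), genBessel a d c b lam n k * (s ^ k * t ^ (n - k)) =
      genBessel a d c (t * b) (t * lam + s) n 0 := by
  rw [← genBesselRow_eq_zeroth_column, genBesselRow]
  exact Finset.sum_congr rfl fun k _ => by rw [genBessel_mul_mul]; ring

theorem isFiniteMeasure_of_integrable_pow {μ : Measure ℝ}
    (h : ∀ n : ℕ, Integrable (fun x : ℝ => x ^ n) μ) : IsFiniteMeasure μ := by
  simpa [integrable_const_iff] using h 0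

theorem momentFunctional_convolution {μ ν : Measure ℝ} [SFinite μ] [SFinite ν]
    (hμ : ∀ n : ℕ, Integrable (fun x : ℝ => x ^ n) μ)
    (hν : ∀ n : ℕ, Integrable (fun x : ℝ => x ^ n) ν)
    (a : ℕ) (d c b lam : ℝ) (P : Polynomial ℝ) :
    momentFunctional (fun n => ∑ k ∈ Finset.range (n + 1),
        genBessel a d c b lam n k * (∫ s, s ^ k ∂μ) * ∫ t, t ^ (n - k) ∂ν) P =
      ∫ z : ℝ × ℝ, momentFunctional
        (fun n => genBessel a d c (z.2 * b) (z.2 * lam + z.1) n 0) P ∂(μ.prod ν) := by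
  have hprod : ∀ n k : ℕ, Integrable (fun z : ℝ × ℝ => z.1 ^ k * z.2 ^ (n - k)) (μ.prod ν) :=
    fun n k => (hμ k).mul_prod (hν (n - k))
  have hrow : ∀ n : ℕ, Integrable (fun z : ℝ × ℝ => ∑ k ∈ Finset.range (n + 1),
      genBessel a d c b lam n k * (z.1 ^ k * z.2 ^ (n - k))) (μ.prod ν) := fun n =>
    integrable_finsetSum _ fun k _ => (hprod n k).const_mul _
  simp only [momentFunctional_eq_sum, ← sum_genBessel_mul_pow_mul_pow]
  rw [integral_finsetSum _ fun n _ => (hrow n).const_mul _]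
  refine Finset.sum_congr rfl fun n _ => ?_
  rw [integral_const_mul, integral_finsetSum _ fun k _ => (hprod n k).const_mul _]
  congr 1
  refine Finset.sum_congr rfl fun k _ => ?_
  rw [integral_const_mul, integral_prod_mul (fun s : ℝ => s ^ k) fun t : ℝ => t ^ (n - k),
    mul_assoc]

/-- By homogeneity the convolution of the moments of `s` and `t` is the mean of the moment positive
sequences `T n 0` at `(t * b, t * lam + s)`. -/
theorem convolutionPreservesSM_genBessel {a : ℕ} (ha : 0 < a) {d c b lam : ℝ} (hd : 0 ≤ d)
    (hc : 0 ≤ c) (hb : 0 ≤ b) (hlam : 0 ≤ lam) :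
    ConvolutionPreservesSM (genBessel a d c b lam) := by
  rintro x y ⟨μ, hμ_nonneg, hμ⟩ ⟨ν, hν_nonneg, hν⟩
  have := isFiniteMeasure_of_integrable_pow fun n => (hμ n).1
  have := isFiniteMeasure_of_integrable_pow fun n => (hν n).1
  refine IsMomentPositive.isStieltjesMoment fun P hP => ?_
  simp only [← (hμ _).2, ← (hν _).2]
  rw [momentFunctional_convolution (fun n => (hμ n).1) fun n => (hν n).1]
  have hfst : ∀ᵐ z ∂(μ.prod ν), z.1 ∉ Set.Iio 0 :=
    Measure.quasiMeasurePreserving_fst.ae (measure_eq_zero_iff_ae_notMem.1 hμ_nonneg)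
  have hsnd : ∀ᵐ z ∂(μ.prod ν), z.2 ∉ Set.Iio 0 :=
    Measure.quasiMeasurePreserving_snd.ae (measure_eq_zero_iff_ae_notMem.1 hν_nonneg)
  refine integral_nonneg_of_ae ?_
  filter_upwards [hfst, hsnd] with z hs ht
  rw [Set.mem_Iio, not_lt] at hs ht
  exact isMomentPositive_genBessel ha hd hc (by positivity) (by positivity) P hP

end Convolution

/-! ### The explicit formula -/

section Explicit

open Polynomial

/-- The alternating binomial sum of the explicit formula, with the falling factorial written as
`a ^ n * (x)_n = (-1) ^ n * ∏ l < n, (a * l - a * x)` at `x = (i - a * d) / a`. -/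
noncomputable def alternatingSum (a : ℕ) (d : ℝ) (n m : ℕ) : ℝ :=
  ∑ i ∈ Finset.range (m + 1), (-1 : ℝ) ^ i * m.choose i * ∏ l ∈ Finset.range n, (a * l + a * d - i)

theorem alternatingSum_zero (a : ℕ) (d : ℝ) (m : ℕ) :
    alternatingSum a d 0 m = if m = 0 then 1 else 0 := by
  simpa [alternatingSum] using
    congrArg (Int.cast : ℤ → ℝ) (Int.alternating_sum_range_choose (n := m))

theorem alternatingSum_succ_zero (a : ℕ) (d : ℝ) (n : ℕ) :
    alternatingSum a d (n + 1) 0 = (a * n + a * d) * alternatingSum a d n 0 := by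
  simp [alternatingSum, Finset.prod_range_succ, mul_comm]

theorem succ_mul_alternatingSum (a : ℕ) (d : ℝ) (n m : ℕ) :
    (m + 1) * alternatingSum a d n m = ∑ i ∈ Finset.range (m + 2),
      (m + 1 - i) * ((-1 : ℝ) ^ i * (m + 1).choose i *
        ∏ l ∈ Finset.range n, (a * l + a * d - i)) := by
  rw [alternatingSum, Finset.sum_range_succ _ (m + 1), Finset.mul_sum]
  simp only [Nat.cast_add, Nat.cast_one, sub_self, zero_mul, add_zero]
  refine Finset.sum_congr rfl fun i hi => ?_
  have hchoose := congrArg (Nat.cast : ℕ → ℝ) (Nat.choose_mul_succ_eq m i)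
  push_cast [(Finset.mem_range.1 hi).le] at hchoose
  linear_combination (-1 : ℝ) ^ i * (∏ l ∈ Finset.range n, (a * l + a * d - i)) * hchoose

theorem alternatingSum_succ_succ (a : ℕ) (d : ℝ) (n m : ℕ) :
    alternatingSum a d (n + 1) (m + 1) =
      (a * n + a * d - (m + 1)) * alternatingSum a d n (m + 1) +
        (m + 1) * alternatingSum a d n m := by
  rw [succ_mul_alternatingSum, alternatingSum, alternatingSum, Finset.mul_sum,
    ← Finset.sum_add_distrib]
  refine Finset.sum_congr rfl fun i _ => ?_
  rw [Finset.prod_range_succ]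
  ring

theorem alternatingSum_eq_zero_of_lt (a : ℕ) (d : ℝ) (n : ℕ) :
    ∀ m, n < m → alternatingSum a d n m = 0 := by
  induction n with
  | zero => intro m hm; rw [alternatingSum_zero, if_neg hm.ne']
  | succ n ih =>
    rintro (_ | m) hm
    · omega
    · rw [alternatingSum_succ_succ, ih _ (by omega), ih _ (by omega), mul_zero, mul_zero, add_zero]

theorem genBessel_eq_alternatingSum (a : ℕ) (d c b : ℝ) (n : ℕ) : ∀ m,
    genBessel a d c b 0 n m =
      b ^ (n - m) * c ^ m * (alternatingSum a d n m / (m.factorial : ℝ)) := by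
  induction n with
  | zero => rintro (_ | m) <;> simp [genBessel, alternatingSum_zero]
  | succ n ih =>
    rintro (_ | m)
    · simp only [genBessel, ih, alternatingSum_succ_zero, smul_eq_mul, Nat.sub_zero, pow_succ,
        mul_zero, add_zero, zero_mul, sub_zero, Nat.factorial_zero, Nat.cast_one]
      ring
    · have hpow : b ^ (n - (m + 1)) * b * alternatingSum a d n (m + 1) =
          b ^ (n - m) * alternatingSum a d n (m + 1) := by
        rcases le_or_gt (m + 1) n with hle | hlt
        · rw [← pow_succ, show n - (m + 1) + 1 = n - m by omega]
        · rw [alternatingSum_eq_zero_of_lt a d n _ hlt, mul_zero, mul_zero]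
      simp only [genBessel, ih, alternatingSum_succ_succ, Nat.add_sub_add_right, smul_eq_mul,
        Nat.factorial_succ, mul_zero, add_zero, zero_mul, sub_zero]
      push_cast
      field_simp
      linear_combination c * c ^ m * (a * n - (m + 1) + a * d) * hpow

theorem hasSum_choose_mul_genBessel (a : ℕ) (d c b lam : ℝ) (n k : ℕ) :
    HasSum (fun j : ℕ => ((k + j).choose k : ℝ) * lam ^ j * genBessel a d c b 0 n (k + j))
      (genBessel a d c b lam n k) := by
  have hdegree : (hasseDeriv k (genBesselPoly a d c b 0 n)).natDegree < n + 1 := by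
    refine Nat.lt_succ_of_le ((natDegree_hasseDeriv_le _ _).trans
      ((Nat.sub_le _ _).trans (natDegree_le_iff_coeff_eq_zero.2 fun m hm => ?_)))
    rw [coeff_genBesselPoly, genBessel_eq_zero_of_lt _ _ _ _ _ _ _ hm]
  rw [← coeff_genBesselPoly, ← zero_add lam, ← taylor_genBesselPoly, taylor_coeff,
    eval_eq_sum_range' hdegree]
  simp only [hasseDeriv_coeff, coeff_genBesselPoly, zero_add, add_comm _ k,
    mul_right_comm _ _ (lam ^ _)]
  refine hasSum_sum_of_ne_finset_zero fun j hj => ?_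
  rw [Finset.mem_range, not_lt] at hj
  rw [genBessel_eq_zero_of_lt _ _ _ _ _ _ (k + j) (by omega), mul_zero]

theorem zpow_mul_alternatingSum (a : ℕ) (d b : ℝ) (n m : ℕ) :
    b ^ ((n : ℤ) - m) * alternatingSum a d n m = b ^ (n - m) * alternatingSum a d n m := by
  rcases le_or_gt m n with hle | hlt
  · rw [← Nat.cast_sub hle, zpow_natCast]
  · rw [alternatingSum_eq_zero_of_lt a d n _ hlt, mul_zero, mul_zero]

theorem prod_range_eq_descPochhammer {a : ℕ} (ha : 0 < a) (d x : ℝ) (n : ℕ) :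
    ∏ l ∈ Finset.range n, (a * l + a * d - x) =
      (-1) ^ n * (a : ℝ) ^ n * (descPochhammer ℝ n).eval ((x - a * d) / a) := by
  have ha' : (a : ℝ) ≠ 0 := Nat.cast_ne_zero.2 ha.ne'
  nth_rw 2 3 [← Finset.card_range n]
  rw [descPochhammer_eval_eq_prod_range, ← mul_pow, Finset.pow_card_mul_prod]
  exact Finset.prod_congr rfl fun l _ => by field_simp; ring

theorem neg_one_zpow_sub (n i : ℕ) : (-1 : ℝ) ^ ((n : ℤ) - i) = (-1) ^ n * (-1) ^ i := by
  rw [zpow_sub₀ (by norm_num), zpow_natCast, zpow_natCast, div_eq_mul_inv, ← inv_pow,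
    inv_neg_one]

theorem hasSum_genBessel {a : ℕ} (ha : 0 < a) (d c b lam : ℝ) (n k : ℕ) :
    HasSum
      (fun j : ℕ => (a : ℝ) ^ n / (k.factorial : ℝ) *
        ∑ i ∈ Finset.range (k + j + 1),
          (-1 : ℝ) ^ ((n : ℤ) - (i : ℤ)) * b ^ ((n : ℤ) - (k : ℤ) - (j : ℤ)) * c ^ (k + j) *
            lam ^ j / (j.factorial : ℝ) * ((k + j).choose i : ℝ) *
            (descPochhammer ℝ n).eval (((i : ℝ) - a * d) / a))
      (genBessel a d c b lam n k) := by
  convert! hasSum_choose_mul_genBessel a d c b lam n k using 2 with j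
  have hchoose : ((k + j).choose k : ℝ) / (k + j).factorial = 1 / (k.factorial * j.factorial) := by
    rw [Nat.cast_add_choose]
    field_simp
  calc _ = b ^ ((n : ℤ) - (k + j : ℕ)) * alternatingSum a d n (k + j) * c ^ (k + j) * lam ^ j *
        (1 / (k.factorial * j.factorial)) := by
        simp only [alternatingSum, prod_range_eq_descPochhammer ha, neg_one_zpow_sub,
          Finset.mul_sum, Finset.sum_mul, Nat.cast_add, sub_sub]
        exact Finset.sum_congr rfl fun i _ => by ring
    _ = b ^ (n - (k + j)) * alternatingSum a d n (k + j) * c ^ (k + j) * lam ^ j *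
        (((k + j).choose k : ℝ) / (k + j).factorial) := by
        rw [zpow_mul_alternatingSum, hchoose]
    _ = _ := by
        rw [genBessel_eq_alternatingSum]
        ring

end Explicit

/-! ### The signless Bessel numbers -/

/-- The signless Bessel number `b_{k + j + 1, k + 1}`. -/
noncomputable def besselCoeff (k j : ℕ) : ℝ :=
  (k + 2 * j).factorial / (k.factorial * j.factorial * 2 ^ j)

theorem besselCoeff_zero_right (k : ℕ) : besselCoeff k 0 = 1 := by
  simp [besselCoeff, Nat.factorial_ne_zero]

theorem besselCoeff_zero_succ (j : ℕ) :
    besselCoeff 0 (j + 1) = (2 * j + 1) * besselCoeff 0 j := by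
  simp only [besselCoeff, show 0 + 2 * (j + 1) = 0 + 2 * j + 1 + 1 by ring, Nat.factorial_succ]
  push_cast
  field_simp
  ring

theorem besselCoeff_succ_succ (k j : ℕ) :
    besselCoeff (k + 1) (j + 1) =
      besselCoeff k (j + 1) + (k + 2 * j + 2) * besselCoeff (k + 1) j := by
  simp only [besselCoeff, show k + 1 + 2 * (j + 1) = k + 2 * j + 1 + 1 + 1 by ring,
    show k + 2 * (j + 1) = k + 2 * j + 1 + 1 by ring,
    show k + 1 + 2 * j = k + 2 * j + 1 by ring, Nat.factorial_succ]
  push_cast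
  field_simp
  ring

theorem genBessel_two_succ_zero (n : ℕ) : genBessel 2 0 1 (1 : ℝ) 0 (n + 1) 0 = 0 := by
  induction n with
  | zero => simp [genBessel]
  | succ n ih => rw [genBessel, ih]; simp

theorem genBessel_two_succ_succ (n k : ℕ) :
    genBessel 2 0 1 (1 : ℝ) 0 (n + 1) (k + 1) = genBessel 2 0 1 (1 : ℝ) 0 n k +
      (2 * n - (k + 1)) * genBessel 2 0 1 (1 : ℝ) 0 n (k + 1) := by
  simp [genBessel]

theorem genBessel_two_eq_besselCoeff (j : ℕ) :
    ∀ k, genBessel 2 0 1 (1 : ℝ) 0 (k + j + 1) (k + 1) = besselCoeff k j := by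
  induction j with
  | zero =>
    intro k
    rw [besselCoeff_zero_right]
    induction k with
    | zero => simp [genBessel]
    | succ k ih =>
      rw [genBessel_two_succ_succ, genBessel_eq_zero_of_lt _ _ _ _ _ _ (k + 1 + 1) (by omega),
        mul_zero, add_zero]
      exact ih
  | succ j ihj =>
    intro k
    rw [genBessel_two_succ_succ]
    induction k with
    | zero =>
      rw [show 0 + (j + 1) = 0 + j + 1 by ring, ihj 0, genBessel_two_succ_zero,
        besselCoeff_zero_succ]
      push_cast
      ring
    | succ k ih =>
      rw [show k + 1 + (j + 1) = k + (j + 1) + 1 by ring, genBessel_two_succ_succ, ih,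
        show k + (j + 1) + 1 = k + 1 + j + 1 by ring, ihj, besselCoeff_succ_succ]
      push_cast
      ring

theorem coeff_besselPolynomial (k j : ℕ) :
    (besselPolynomial (k + j)).coeff j = besselCoeff k j := by
  have hlt : ¬ k + (j + 1) ≤ j := by omega
  simp [besselPolynomial, besselCoeff, div_div, add_assoc, two_mul, hlt]

theorem coeff_besselPolynomial_succ (n : ℕ) : (besselPolynomial n).coeff (n + 1) = 0 := by
  simp [besselPolynomial]

theorem genBessel_two_eq_signlessBessel (n k : ℕ) :
    genBessel 2 0 1 (1 : ℝ) 0 n k = signlessBessel n k := by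
  rcases n, k with ⟨_ | n, _ | k⟩
  · simp [genBessel, signlessBessel]
  · simp [genBessel, signlessBessel]
  · rw [genBessel_two_succ_zero, signlessBessel, if_pos (Nat.zero_le _), Nat.sub_zero,
      coeff_besselPolynomial_succ]
  · rcases le_or_gt k n with hle | hlt
    · obtain ⟨j, rfl⟩ := Nat.exists_eq_add_of_le hle
      rw [genBessel_two_eq_besselCoeff, signlessBessel, if_pos (by omega),
        show k + j + 1 - (k + 1) = j by omega, coeff_besselPolynomial]
    · rw [genBessel_eq_zero_of_lt _ _ _ _ _ _ _ (by omega), signlessBessel, if_neg (by omega)]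

/-! ### The generating function -/

section GeneratingFunction

open Filter Topology

theorem genBessel_succ_zero_of_lam_eq_zero (a : ℕ) (d c b : ℝ) (n : ℕ) :
    genBessel a d c b 0 (n + 1) 0 = (a * n + a * d) * b * genBessel a d c b 0 n 0 := by
  simp [genBessel]

theorem factorial_succ_mul_choose_succ (r : ℝ) (n : ℕ) :
    ((n + 1).factorial : ℝ) * Ring.choose r (n + 1) =
      (r - n) * ((n.factorial : ℝ) * Ring.choose r n) := by
  have hdesc (n : ℕ) :
      (n.factorial : ℝ) * Ring.choose r n = (descPochhammer ℤ n).smeval r := by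
    rw [Ring.descPochhammer_eq_factorial_smul_choose, nsmul_eq_mul]
  rw [hdesc, hdesc, descPochhammer_succ_right, Polynomial.smeval_mul]
  simp [Polynomial.smeval_sub, Polynomial.smeval_natCast, mul_comm]

theorem neg_pow_mul_factorial_mul_choose_one_div {a : ℕ} (ha : 0 < a) (c b : ℝ) (n : ℕ) :
    -(-(a * b)) ^ (n + 1) * ((n + 1).factorial * Ring.choose (1 / (a : ℝ)) (n + 1)) =
      b * genBessel a ((a - 1) / a) c b 0 n 0 := by
  have ha' : (a : ℝ) ≠ 0 := Nat.cast_ne_zero.2 ha.ne'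
  induction n with
  | zero => simp [genBessel]; field_simp
  | succ n ih =>
    have hfactor : (1 / (a : ℝ) - ((n + 1 : ℕ) : ℝ)) * -(a * b) =
        (a * n + a * ((a - 1) / a)) * b := by
      push_cast
      field_simp
      ring
    rw [factorial_succ_mul_choose_succ, genBessel_succ_zero_of_lam_eq_zero, ← hfactor, pow_succ]
    linear_combination (1 / (a : ℝ) - ((n + 1 : ℕ) : ℝ)) * -(a * b) * ih

theorem hasSum_generatingFunction {a : ℕ} (ha : 0 < a) (c : ℝ) {b : ℝ} (hb : b ≠ 0) :
    ∀ᶠ t : ℝ in 𝓝 0, HasSum (fun n : ℕ => c * genBessel a ((a - 1) / a) c b 0 n 0 *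
      (t ^ (n + 1) / ((n + 1).factorial : ℝ))) (c / b * (1 - (1 - a * b * t) ^ (1 / (a : ℝ)))) := by
  have hcont : Continuous fun t : ℝ => -(a * b * t) := by fun_prop
  filter_upwards [hcont.continuousAt.eventually_mem (Metric.isOpen_eball.mem_nhds
    (by simp : -(a * b * 0) ∈ Metric.eball (0 : ℝ) 1))] with t ht
  have hbinomial :=
    (Real.one_add_rpow_hasFPowerSeriesOnBall_zero (a := 1 / (a : ℝ))).hasSum ht
  simp only [binomialSeries_apply, List.ofFn_const, List.prod_replicate, smul_eq_mul,
    zero_add] at hbinomial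
  convert! ((hasSum_nat_add_iff' 1).2 hbinomial).mul_left (-(c / b)) using 1
  · funext n
    have hcoeff := neg_pow_mul_factorial_mul_choose_one_div ha c b n
    rw [show -(a * b * t) = -(a * b) * t by ring, mul_pow]
    field_simp
    linear_combination (-c) * t ^ (n + 1) * hcoeff
  · simp
    ring_nf

theorem isStieltjesMoment_generatingFunction {a : ℕ} (ha : 0 < a) {c b : ℝ} (hc : 0 ≤ c)
    (hb : 0 ≤ b) : IsStieltjesMoment fun n => c * genBessel a ((a - 1) / a) c b 0 n 0 := by
  have hd : 0 ≤ ((a : ℝ) - 1) / a :=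
    div_nonneg (sub_nonneg.2 (Nat.one_le_cast.2 ha)) a.cast_nonneg
  exact ((isMomentPositive_genBessel ha hd hc hb le_rfl).const_mul hc).isStieltjesMoment

end GeneratingFunction

theorem coeffSM_coeffLogConvex_genBesselRow {σ : Type*} {a p : ℕ} {d c : ℝ} (hp : p < a)
    (hd : (a : ℝ) * d = p) (hc : 0 < c) (i j k : σ) :
    CoeffSM (genBesselRow a d c (MvPolynomial.X i : MvPolynomial σ ℝ)
        (MvPolynomial.X j) (MvPolynomial.X k)) ∧
      CoeffLogConvex 3 (genBesselRow a d c (MvPolynomial.X i : MvPolynomial σ ℝ)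
        (MvPolynomial.X j) (MvPolynomial.X k)) := by
  rw [funext (genBesselRow_eq_zeroth_column a d c _ _ _)]
  exact coeffSM_coeffLogConvex_genBessel hp hd hc (X_mem_nonnegCoeffsSubsemiring i)
    (add_mem (X_mem_nonnegCoeffsSubsemiring j) (X_mem_nonnegCoeffsSubsemiring k))

theorem mainTheorem11_general (a : ℕ) (ha : 0 < a) (d c : ℝ) :
    (∀ n k : ℕ, genBessel 2 0 1 (1 : ℝ) 0 n k = signlessBessel n k) ∧
    (∀ (b lam : ℝ) (n k : ℕ),
      HasSum
        (fun j : ℕ => (a : ℝ) ^ n / (k.factorial : ℝ) *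
          ∑ i ∈ Finset.range (k + j + 1),
            (-1 : ℝ) ^ ((n : ℤ) - (i : ℤ)) * b ^ ((n : ℤ) - (k : ℤ) - (j : ℤ)) * c ^ (k + j) *
              lam ^ j / (j.factorial : ℝ) * ((k + j).choose i : ℝ) *
              (descPochhammer ℝ n).eval (((i : ℝ) - a * d) / a))
        (genBessel a d c b lam n k)) ∧
    ((∃ p : ℕ, (a : ℝ) * d = p) → 0 < c →
      CoeffTP (genBessel a d c (MvPolynomial.X 0 : MvPolynomial (Fin 2) ℝ) (MvPolynomial.X 1))) ∧
    ((∃ p : ℕ, (a : ℝ) * d = p) → 0 < c → (a : ℝ) * d ≤ a - 1 →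
      CoeffSM (genBesselRow a d c (MvPolynomial.X 0 : MvPolynomial (Fin 3) ℝ)
        (MvPolynomial.X 1) (MvPolynomial.X 2)) ∧
      CoeffLogConvex 3 (genBesselRow a d c (MvPolynomial.X 0 : MvPolynomial (Fin 3) ℝ)
        (MvPolynomial.X 1) (MvPolynomial.X 2)) ∧
      CoeffSM (fun n => genBessel a d c (MvPolynomial.X 0 : MvPolynomial (Fin 2) ℝ)
        (MvPolynomial.X 1) n 0) ∧
      CoeffLogConvex 3 (fun n => genBessel a d c (MvPolynomial.X 0 : MvPolynomial (Fin 2) ℝ)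
        (MvPolynomial.X 1) n 0)) ∧
    (0 ≤ c → ∀ b : ℝ, 0 < b →
      ∃ f : ℕ → ℝ,
        (∀ᶠ t : ℝ in nhds 0,
          HasSum (fun n : ℕ => f (n + 1) * (t ^ (n + 1) / ((n + 1).factorial : ℝ)))
            (c / b * (1 - (1 - a * b * t) ^ (1 / (a : ℝ))))) ∧
        IsStieltjesMoment fun n => f (n + 1)) ∧
    (0 ≤ d → 0 ≤ c → ∀ b lam : ℝ, 0 ≤ b → 0 ≤ lam →
      ConvolutionPreservesSM (genBessel a d c b lam)) := by
  refine ⟨genBessel_two_eq_signlessBessel, hasSum_genBessel ha d c, fun ⟨p, hd⟩ hc =>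
    coeffTP_genBessel ha hd hc 0 1, fun ⟨p, hd⟩ hc hle => ?_, fun hc b hb =>
    ⟨fun n => c * genBessel a ((a - 1) / a) c b 0 (n - 1) 0,
      hasSum_generatingFunction ha c hb.ne', isStieltjesMoment_generatingFunction ha hc hb.le⟩,
    fun hd hc b lam hb hlam => convolutionPreservesSM_genBessel ha hd hc hb hlam⟩
  have hp : p < a := by
    rw [hd, le_sub_iff_add_le] at hle
    exact_mod_cast hle
  have hrow := coeffSM_coeffLogConvex_genBesselRow hp hd hc (0 : Fin 3) 1 2
  have hcolumn := coeffSM_coeffLogConvex_genBessel hp hd hc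
    (X_mem_nonnegCoeffsSubsemiring (0 : Fin 2)) (X_mem_nonnegCoeffsSubsemiring 1)
  exact ⟨hrow.1, hrow.2, hcolumn.1, hcolumn.2⟩

theorem mainTheorem11 (a : ℕ) (ha : 0 < a) (d : ℝ) (had : ∃ p : ℕ, (a : ℝ) * d = p)
    (c : ℝ) (hc : 0 < c) :
    -- the signless Bessel numbers of the first kind as a special case
    (∀ n k : ℕ, genBessel 2 0 1 (1 : ℝ) 0 n k = signlessBessel n k) ∧
    -- (i) explicit formula; `descPochhammer` gives the falling factorial
    (∀ (b lam : ℝ) (n k : ℕ),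
      HasSum
        (fun j : ℕ => (a : ℝ) ^ n / (k.factorial : ℝ) *
          ∑ i ∈ Finset.range (k + j + 1),
            (-1 : ℝ) ^ ((n : ℤ) - (i : ℤ)) * b ^ ((n : ℤ) - (k : ℤ) - (j : ℤ)) * c ^ (k + j) *
              lam ^ j / (j.factorial : ℝ) * ((k + j).choose i : ℝ) *
              (descPochhammer ℝ n).eval (((i : ℝ) - a * d) / a))
        (genBessel a d c b lam n k)) ∧
    -- (ii) total positivity in the indeterminates `b = X 0`, `lam = X 1`
    CoeffTP (genBessel a d c (MvPolynomial.X 0 : MvPolynomial (Fin 2) ℝ) (MvPolynomial.X 1)) ∧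
    -- (iii) in the indeterminates `b = X 0`, `lam = X 1`, `q = X 2`
    ((a : ℝ) * d ≤ a - 1 →
      CoeffSM (genBesselRow a d c (MvPolynomial.X 0 : MvPolynomial (Fin 3) ℝ)
        (MvPolynomial.X 1) (MvPolynomial.X 2)) ∧
      CoeffLogConvex 3 (genBesselRow a d c (MvPolynomial.X 0 : MvPolynomial (Fin 3) ℝ)
        (MvPolynomial.X 1) (MvPolynomial.X 2)) ∧
      CoeffSM (fun n => genBessel a d c (MvPolynomial.X 0 : MvPolynomial (Fin 2) ℝ)
        (MvPolynomial.X 1) n 0) ∧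
      CoeffLogConvex 3 (fun n => genBessel a d c (MvPolynomial.X 0 : MvPolynomial (Fin 2) ℝ)
        (MvPolynomial.X 1) n 0)) ∧
    -- (iv) `f n` is indexed by `n ≥ 1`
    (∀ b : ℝ, 0 < b →
      ∃ f : ℕ → ℝ,
        (∀ᶠ t : ℝ in nhds 0,
          HasSum (fun n : ℕ => f (n + 1) * (t ^ (n + 1) / ((n + 1).factorial : ℝ)))
            (c / b * (1 - (1 - a * b * t) ^ (1 / (a : ℝ))))) ∧
        IsStieltjesMoment fun n => f (n + 1)) ∧
    -- (v) the convolution preserves the Stieltjes moment property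
    ((a : ℝ) * d ≤ a - 1 → ∀ b lam : ℝ, 0 ≤ b → 0 ≤ lam →
      ConvolutionPreservesSM (genBessel a d c b lam)) := by
  have hd : 0 ≤ d := by
    obtain ⟨p, hp⟩ := had
    exact (mul_nonneg_iff_of_pos_left (Nat.cast_pos.2 ha)).1 (hp ▸ p.cast_nonneg)
  obtain ⟨hBessel, hformula, hTP, hSM, hgenerating, hconvolution⟩ := mainTheorem11_general a ha d c
  exact ⟨hBessel, hformula, hTP had hc, hSM had hc, hgenerating hc.le,
    fun _ => hconvolution hd hc.le⟩
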